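/- Let $X$ be a C*-algebra and let $\mathcal F\subset X^*$ be a norm-closed subspace such that $(X,\mathcal F)$ is a dual pair of Banach spaces: $\|x\|=\sup\{|\varphi(x)|:\varphi\in\mathcal F,\ \|\varphi\|\le 1\}$ for $x\in X$; $\|\varphi\|=\sup\{|\varphi(x)|:x\in X,\ \|x\|\le 1\}$ for $\varphi\in\mathcal F$; the convex hull of every relatively $\mathcal F$-compact subset of $X$ is relatively $\mathcal F$-compact; and the convex hull of every relatively $X$-compact subset of $\mathcal F$ is relatively $X$-compact. Here the $\mathcal F$-topology on $X$ is $\sigma(X,\mathcal F)$, the $X$-topology on $\mathcal F$ is $\sigma(\mathcal F,X)$, and $\overline{\,\cdot\,}^{\sigma}$ denotes closure in the $\mathcal F$-topology. Assume that the involution of $X$ is $\mathcal F$-continuous and that the multiplication of $X$ is separately $\mathcal F$-continuous. Let $G$ be a compact group and let $\alpha:G\to\mathrm{Aut}(X)$ be a homomorphism into the group of $*$-automorphisms of $X$ such that $(X,G,\alpha)$ is an $\mathcal F$-dynamical system: every $\alpha_g$ is $\mathcal F$-continuous, and $g\mapsto\varphi(\alpha_g(x))$ is continuous for all $x\in X$,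 $\varphi\in\mathcal F$. Let $X^\alpha=\{x\in X:\alpha_g(x)=x\ \text{for all } g\in G\}$. Let $\widehat G$ be the set of unitary equivalence classes of (continuous, hence finite-dimensional) irreducible unitary representations of $G$; for each class fix a representative $\pi$ on $H_\pi$, written as a matrix-valued function in an orthonormal basis, and identify $X\otimes B(H_\pi)$ with the matrices over $X$, with the topology of entrywise $\mathcal F$-convergence. For an $\mathcal F$-closed $\alpha$-invariant $*$-subalgebra $Y\subset X$ put $$Y_2(\pi)=\{a\in Y\otimes B(H_\pi):(\alpha_g\otimes\iota)(a)=a(1\otimes\pi_g)\ \text{for all } g\in G\},$$ $$(Y\otimes B(H_\pi))^{\alpha\otimes \mathrm{ad}\,\pi}=\{a\in Y\otimes B(H_\pi):(1\otimes\pi_g)\,(\alpha_g\otimes\iota)(a)\,(1\otimes\pi_{g^{-1}})=a\ \text{for all } g\in G\},$$ and let $Y_2(\pi)^*Y_2(\pi)$ be the linear span of the products $a^*b$ with $a,b\in Y_2(\pi)$. The strong Arveson spectrum of the restricted action is $$\widetilde{sp}_{\mathcal F}(\alpha|_Y)=\{\pi\in\widehat G:\overline{Y_2(\pi)^*Y_2(\pi)}^{\sigma}=(Y\otimes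 B(H_\pi))^{\alpha\otimes \mathrm{ad}\,\pi}\}.$$ The strong Connes spectrum is $$\widetilde\Gamma_{\mathcal F}(\alpha)=\bigcap\{\widetilde{sp}_{\mathcal F}(\alpha|_Y): Y\in\mathcal H^\alpha_\sigma(X)\},$$ where $\mathcal H^\alpha_\sigma(X)$ is the set of all non-zero globally $\alpha$-invariant $\mathcal F$-closed hereditary C*-subalgebras of $X$. (An intersection over an empty family is $\widehat G$.) Then $$\widetilde\Gamma_{\mathcal F}(\alpha)=\bigcap\big\{\widetilde{sp}_{\mathcal F}\big(\alpha|_{\overline{JXJ}^{\sigma}}\big): J\subset X^\alpha\ \text{an } \mathcal F\text{-closed two-sided ideal of } X^\alpha\big\},$$ where $JXJ$ denotes the linear span of the products $jxk$ with $j,k\in J$, $x\in X$. -/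

import Mathlib

open Topology

namespace FDyn

section DualPair

variable {E : Type*} [NormedAddCommGroup E] [NormedSpace ℂ E]

/-- The `F`-topology on `E`: the weakest topology for which all functionals in `F` are
continuous. -/
noncomputable abbrev fTop (F : Submodule ℂ (StrongDual ℂ E)) : TopologicalSpace E :=
  TopologicalSpace.induced (fun (x : E) (φ : F) => (φ : StrongDual ℂ E) x) inferInstance

/-- The `E`-topology on `F`: the topology of pointwise convergence on `E`. -/
noncomputable abbrev preTop (F : Submodule ℂ (StrongDual ℂ E)) : TopologicalSpace F :=
  TopologicalSpace.induced (fun (φ : F) (x : E) => (φ : StrongDual ℂ E) x) inferInstance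

/-- `S` is relatively compact for the topology `t`. -/
def RelCompact {T : Type*} (t : TopologicalSpace T) (S : Set T) : Prop :=
  @IsCompact T t (closure[t] S)

/-- `(E, F)` is a dual pair of Banach spaces, `F` being a space of functionals on `E` with the
dual norm. -/
structure IsDualPair (F : Submodule ℂ (StrongDual ℂ E)) : Prop where
  isClosed : IsClosed (F : Set (StrongDual ℂ E))
  norm_eq : ∀ x : E, IsLUB {r : ℝ | ∃ φ ∈ F, ‖φ‖ ≤ 1 ∧ r = ‖φ x‖} ‖x‖
  norm_dual_eq : ∀ φ ∈ F, IsLUB {r : ℝ | ∃ x : E, ‖x‖ ≤ 1 ∧ r = ‖φ x‖} ‖φ‖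
  relCompact_convexHull : ∀ K : Set E, RelCompact (fTop F) K →
    RelCompact (fTop F) (convexHull ℝ K)
  relCompact_convexHull_dual : ∀ K : Set F, RelCompact (preTop F) K →
    RelCompact (preTop F) (convexHull ℝ K)

/-- The topology on `d × d` matrices over `E` (that is, on `E ⊗ M_d(ℂ)`) given by the
functionals in `F ⊗ M_d(ℂ)^*`: entrywise convergence in the `F`-topology. -/
noncomputable abbrev fTopMat (F : Submodule ℂ (StrongDual ℂ E)) (d : ℕ) :
    TopologicalSpace (Matrix (Fin d) (Fin d) E) :=
  TopologicalSpace.induced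
    (fun (a : Matrix (Fin d) (Fin d) E) (p : F × Fin d × Fin d) =>
      (p.1 : StrongDual ℂ E) (a p.2.1 p.2.2)) inferInstance

end DualPair

section Irrep

/-- The representation on `ℂ^d` defined by a matrix-valued homomorphism. -/
noncomputable def matRep {G : Type*} [Group G] {d : ℕ}
    (u : G →* Matrix.unitaryGroup (Fin d) ℂ) : Representation ℂ G (Fin d → ℂ) :=
  ((Matrix.toLinAlgEquiv' : Matrix (Fin d) (Fin d) ℂ ≃ₐ[ℂ] _) :
      Matrix (Fin d) (Fin d) ℂ →* ((Fin d → ℂ) →ₗ[ℂ] (Fin d → ℂ))).comp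
    ((Submonoid.subtype (Matrix.unitaryGroup (Fin d) ℂ)).comp u)

/-- A continuous irreducible unitary representation of `G` on a finite-dimensional Hilbert space,
written as matrices in an orthonormal basis. -/
structure UnitaryIrrep (G : Type*) [Group G] [TopologicalSpace G] where
  dim : ℕ
  mat : G →* Matrix.unitaryGroup (Fin dim) ℂ
  continuous_mat : Continuous mat
  irreducible : (matRep mat).IsIrreducible

variable {G : Type*} [Group G] [TopologicalSpace G]

/-- The matrix coefficient `π_ij(g)`. -/
def UnitaryIrrep.coeff (π : UnitaryIrrep G) (g : G) (i j : Fin π.dim) : ℂ :=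
  (π.mat g : Matrix (Fin π.dim) (Fin π.dim) ℂ) i j

/-- Unitary equivalence: there is a unitary intertwiner `U` from `H_ρ` onto `H_π`. -/
def UnitaryIrrep.Equivalent (π ρ : UnitaryIrrep G) : Prop :=
  ∃ U : Matrix (Fin π.dim) (Fin ρ.dim) ℂ, U * U.conjTranspose = 1 ∧ U.conjTranspose * U = 1 ∧
    ∀ g, (π.mat g : Matrix (Fin π.dim) (Fin π.dim) ℂ) * U =
      U * (ρ.mat g : Matrix (Fin ρ.dim) (Fin ρ.dim) ℂ)

theorem UnitaryIrrep.equivalent_equivalence :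
    Equivalence (UnitaryIrrep.Equivalent (G := G)) where
  refl π := ⟨1, by simp, by simp, by simp⟩
  symm := by
    rintro π ρ ⟨U, h1, h2, h⟩
    refine ⟨U.conjTranspose, by simpa using h2, by simpa using h1, fun g => ?_⟩
    calc (ρ.mat g).1 * U.conjTranspose
        = (U.conjTranspose * U) * (ρ.mat g).1 * U.conjTranspose := by rw [h2, Matrix.one_mul]
      _ = U.conjTranspose * (U * (ρ.mat g).1) * U.conjTranspose := by simp only [Matrix.mul_assoc]
      _ = U.conjTranspose * (π.mat g).1 * (U * U.conjTranspose) := by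
        rw [← h g]; simp only [Matrix.mul_assoc]
      _ = U.conjTranspose * (π.mat g).1 := by rw [h1, Matrix.mul_one]
  trans := by
    rintro π ρ σ ⟨U, h1, h2, h⟩ ⟨V, k1, k2, k⟩
    refine ⟨U * V, ?_, ?_, fun g => ?_⟩
    · rw [Matrix.conjTranspose_mul, Matrix.mul_assoc, ← Matrix.mul_assoc V, k1, Matrix.one_mul, h1]
    · rw [Matrix.conjTranspose_mul, Matrix.mul_assoc, ← Matrix.mul_assoc _ U, h2, Matrix.one_mul,
        k2]
    · rw [← Matrix.mul_assoc, h g, Matrix.mul_assoc, k g, Matrix.mul_assoc]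

/-- Unitary equivalence as a setoid. -/
def UnitaryIrrep.setoid (G : Type*) [Group G] [TopologicalSpace G] : Setoid (UnitaryIrrep G) :=
  ⟨UnitaryIrrep.Equivalent, UnitaryIrrep.equivalent_equivalence⟩

/-- The dual `Ĝ`: unitary equivalence classes of irreducible representations. -/
def Dual (G : Type*) [Group G] [TopologicalSpace G] : Type _ :=
  Quotient (UnitaryIrrep.setoid G)

/-- A fixed representative of each class in `Ĝ`. -/
noncomputable def Dual.rep (π : Dual G) : UnitaryIrrep G := Quotient.out π

end Irrep

section System

variable {X : Type*} [NonUnitalCStarAlgebra X]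

/-- `(X, G, α)` is an `F`-dynamical system. -/
structure IsFDynamicalSystem {G : Type*} [Group G] [TopologicalSpace G]
    (F : Submodule ℂ (StrongDual ℂ X)) (α : G →* (X ≃⋆ₐ[ℂ] X)) : Prop where
  dualPair : IsDualPair F
  continuous_star : Continuous[fTop F, fTop F] (fun x : X => star x)
  continuous_mul_left : ∀ a : X, Continuous[fTop F, fTop F] (fun x : X => a * x)
  continuous_mul_right : ∀ a : X, Continuous[fTop F, fTop F] (fun x : X => x * a)
  continuous_aut : ∀ g : G, Continuous[fTop F, fTop F] (fun x : X => α g x)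
  continuous_orbit : ∀ x : X, ∀ φ ∈ F, Continuous (fun g : G => φ (α g x))

variable {G : Type*} [Group G] [TopologicalSpace G]

/-- The fixed point algebra `X^α`, as a subset of `X`. -/
def fixedPoints (α : G →* (X ≃⋆ₐ[ℂ] X)) : Set X := {x | ∀ g, α g x = x}

/-- For a subset `Y` of `X`, the spectral subspace `Y_2(π)` of matrices `a` with entries in `Y`
and `(α_g ⊗ ι)(a) = a (1 ⊗ π_g)` for all `g`. -/
def spectralSubspace (α : G →* (X ≃⋆ₐ[ℂ] X)) (Y : Set X) (π : UnitaryIrrep G) :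
    Set (Matrix (Fin π.dim) (Fin π.dim) X) :=
  {a | (∀ i j, a i j ∈ Y) ∧ ∀ g i j, α g (a i j) = ∑ k, π.coeff g k j • a i k}

/-- The fixed point algebra `(Y ⊗ B(H_π))^{α ⊗ ad π}`: the matrices `a` with entries in `Y` and
`(1 ⊗ π_g) [α_g(a_ij)] (1 ⊗ π_{g⁻¹}) = a` for all `g`. -/
def adFixedPoints (α : G →* (X ≃⋆ₐ[ℂ] X)) (Y : Set X) (π : UnitaryIrrep G) :
    Set (Matrix (Fin π.dim) (Fin π.dim) X) :=
  {a | (∀ i j, a i j ∈ Y) ∧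
    ∀ g i j, ∑ k, ∑ l, (π.coeff g i k * π.coeff g⁻¹ l j) • α g (a k l) = a i j}

/-- The strong Arveson spectrum of the restriction `α|_Y`, for an `F`-closed `α`-invariant
`*`-subalgebra `Y` of `X` with the `F`-topology inherited from `X`: the set of all `π` such that
the `F`-closed linear span of the products `a^* b`, `a, b ∈ Y_2(π)`, is all of
`(Y ⊗ B(H_π))^{α ⊗ ad π}`. -/
def strongArvesonSpectrum (F : Submodule ℂ (StrongDual ℂ X)) (α : G →* (X ≃⋆ₐ[ℂ] X))
    (Y : Set X) : Set (Dual G) :=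
  {π | closure[fTopMat F π.rep.dim]
      (Submodule.span ℂ {c : Matrix (Fin π.rep.dim) (Fin π.rep.dim) X |
        ∃ a ∈ spectralSubspace α Y π.rep, ∃ b ∈ spectralSubspace α Y π.rep,
          c = a.conjTranspose * b} : Set (Matrix (Fin π.rep.dim) (Fin π.rep.dim) X))
      = adFixedPoints α Y π.rep}

/-- `Y` is a non-zero globally `α`-invariant `F`-closed hereditary C*-subalgebra of `X`.
(`F`-closed subsets are norm closed.) -/
structure IsInvariantHereditary [PartialOrder X] (F : Submodule ℂ (StrongDual ℂ X))
    (α : G →* (X ≃⋆ₐ[ℂ] X)) (Y : NonUnitalStarSubalgebra ℂ X) : Prop where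
  ne_bot : ∃ y ∈ Y, y ≠ 0
  isClosed : IsClosed[fTop F] (Y : Set X)
  invariant : ∀ g, (fun x : X => α g x) '' (Y : Set X) = Y
  hereditary : ∀ x y : X, 0 ≤ x → x ≤ y → y ∈ Y → x ∈ Y

/-- The strong Connes spectrum of `α`. -/
def strongConnesSpectrum [PartialOrder X] (F : Submodule ℂ (StrongDual ℂ X))
    (α : G →* (X ≃⋆ₐ[ℂ] X)) : Set (Dual G) :=
  {π | ∀ Y : NonUnitalStarSubalgebra ℂ X, IsInvariantHereditary F α Y →
    π ∈ strongArvesonSpectrum F α (Y : Set X)}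

/-- `J` is an `F`-closed two-sided ideal of the fixed point algebra `X^α`. -/
structure IsFClosedIdeal (F : Submodule ℂ (StrongDual ℂ X)) (α : G →* (X ≃⋆ₐ[ℂ] X))
    (J : Submodule ℂ X) : Prop where
  subset : (J : Set X) ⊆ fixedPoints α
  mul_left_mem : ∀ a ∈ fixedPoints α, ∀ j ∈ J, a * j ∈ J
  mul_right_mem : ∀ a ∈ fixedPoints α, ∀ j ∈ J, j * a ∈ J
  isClosed : IsClosed[fTop F] (J : Set X)

/-- The `F`-closure of `JXJ`, the linear span of the products `j x k` with `j, k ∈ J`. -/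
def sandwich (F : Submodule ℂ (StrongDual ℂ X)) (J : Submodule ℂ X) : Set X :=
  closure[fTop F] (Submodule.span ℂ {z : X | ∃ j ∈ J, ∃ x : X, ∃ k ∈ J, z = j * x * k} : Set X)

end System

end FDyn

/-! If J is non-zero, the F-closure of JXJ belongs to the family defining the Connes spectrum; if J
= 0 it is the zero algebra, and both sides of the spectral condition vanish. This gives one
inclusion.

For the other, let Y be an invariant hereditary subalgebra, let J be the F-closed ideal of X^α
generated by Y ∩ X^α, and let Z be the closure of JXJ. Suppose that π lies in the spectrum of α
restricted to Z. A matrix a in (Y ⊗ B(H_π))^{α ⊗ ad π} is a norm limit of cut-downs e a e' with e,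
e' in Y ∩ X^α ⊂ J. Hence a has entries in Z and is an F-limit of sums of products b^*c with b, c in
Z_2(π). It remains to treat e b^*c e'. Fixed points z of Z satisfy zc ≈ c, and z lies in J; so z may
be replaced by x y y' x' with x, x' in X^α and y, y' in Y ∩ X^α. Then e b^* x y y' x' c e' = (y^*
x^* b e)^* (y' x' c e'), and both factors lie in Y_2(π), because YXY ⊂ Y and fixed points preserve
the spectral relation.

Two facts carry this. One is the averaging projection P onto X^α (`exists_average`): the compactness
hypotheses on convex hulls give its existence and its F-continuity. It satisfies P(jxk) = jP(x)k for
j, k in X^α, whence Z ∩ X^α ⊂ J (`mem_of_mem_sandwich`). The other is the existence of fixed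
approximate units (`exists_fixed_approx_unit`): entries of spectral matrices span finite-dimensional
invariant spaces, so averaging an approximate unit keeps the estimate. -/

namespace FDyn

/-! ### Weak integrals over compact spaces. -/

section Barycenter

open MeasureTheory

/-- Weak integrals of continuous functions on a compact space exist as soon as the closed convex
hull of the range is compact. -/
theorem exists_barycenter {E : Type*} [AddCommGroup E] [Module ℝ E] [t : TopologicalSpace E]
    {G : Type*} [TopologicalSpace G] [CompactSpace G] [MeasurableSpace G] [BorelSpace G]
    (μ : Measure G) [IsProbabilityMeasure μ] (f : G → E) (hf : Continuous f)
    (hK : RelCompact t (convexHull ℝ (Set.range f))) :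
    ∃ p ∈ closure (convexHull ℝ (Set.range f)),
      ∀ L : E →ₗ[ℝ] ℂ, Continuous L → L p = ∫ g, L (f g) ∂μ := by
  replace hK : IsCompact (closure (convexHull ℝ (Set.range f))) := hK
  -- By compactness it suffices to satisfy finitely many of the equations at once, which is a
  -- question about a Bochner integral in a finite-dimensional space.
  have key := hK.inter_iInter_nonempty
    (fun L : {L : E →ₗ[ℝ] ℂ // Continuous L} => {p | L.1 p = ∫ g, L.1 (f g) ∂μ})
    (fun L => isClosed_eq L.2 continuous_const) ?_
  · obtain ⟨p, hp, hp'⟩ := key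
    exact ⟨p, hp, fun L hL => Set.mem_iInter.1 hp' ⟨L, hL⟩⟩
  intro u
  let Φ : E →ₗ[ℝ] (u → ℂ) := LinearMap.pi fun i => i.1.1
  have hΦ : Continuous Φ := continuous_pi fun i => i.1.2
  have hint : Integrable (fun g => Φ (f g)) μ :=
    (hΦ.comp hf).integrable_of_hasCompactSupport (HasCompactSupport.of_compactSpace _)
  have hmem : ∫ g, Φ (f g) ∂μ ∈ closure (convexHull ℝ (Set.range fun g => Φ (f g))) :=
    (convex_convexHull ℝ _).closure.integral_mem isClosed_closure
      (Filter.Eventually.of_forall fun g =>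
        subset_closure (subset_convexHull ℝ _ (Set.mem_range_self g))) hint
  -- The image of the compact hull is closed, so the finite-dimensional integral is attained at a
  -- point of the hull.
  have hsub : closure (convexHull ℝ (Set.range fun g => Φ (f g))) ⊆
      Φ '' closure (convexHull ℝ (Set.range f)) := by
    refine closure_minimal ?_ (hK.image hΦ).isClosed
    have : (Set.range fun g => Φ (f g)) = Φ '' Set.range f := by
      rw [← Set.range_comp]; rfl
    rw [this, ← LinearMap.image_convexHull]
    exact Set.image_mono subset_closure
  obtain ⟨p, hp, hpe⟩ := hsub hmem
  refine ⟨p, hp, Set.mem_iInter₂.2 fun i hi => ?_⟩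
  have h1 : Φ p ⟨i, hi⟩ = (∫ g, Φ (f g) ∂μ) ⟨i, hi⟩ := by rw [hpe]
  exact h1.trans ((ContinuousLinearMap.proj (R := ℝ) (φ := fun _ : u => ℂ)
    ⟨i, hi⟩).integral_comp_comm hint).symm

end Barycenter

/-! ### Approximate units and hereditary subalgebras of C*-algebras. -/

section ApproximateUnit

variable {X : Type*} [NonUnitalCStarAlgebra X] [PartialOrder X] [StarOrderedRing X]

/-- A norm closed `*`-subalgebra containing `h ≥ 0` contains self-adjoint approximate left units for
all `x` with `x x^* ≤ h`. -/
theorem exists_approx_unit {S : NonUnitalStarSubalgebra ℂ X} (hS : IsClosed (S : Set X)) {h : X}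
    (hh : 0 ≤ h) (hmem : h ∈ S) {ε : ℝ} (hε : 0 < ε) :
    ∃ e ∈ S, star e = e ∧ ∀ x : X, x * star x ≤ h → ‖x - e * x‖ ≤ ε := by
  -- This cutoff gives t(1 - f(t))² ≤ ε² for all t ≥ 0; vanishing at 0 permits the non-unital
  -- functional calculus.
  obtain ⟨f, hfc, hf0, hf1, hf2, hf3⟩ : ∃ f : ℝ → ℝ, Continuous f ∧ f 0 = 0 ∧ (∀ t, f t ≤ 1) ∧
      (∀ t, 0 ≤ f t) ∧ ∀ t, ε ^ 2 ≤ t → f t = 1 := by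
    refine ⟨fun t => min 1 (max t 0 / ε ^ 2), by fun_prop, by simp, fun t => min_le_left _ _,
      fun t => le_min zero_le_one (by positivity), fun t ht => min_eq_left ?_⟩
    rw [one_le_div (by positivity)]
    exact ht.trans (le_max_left _ _)
  have hsa : IsSelfAdjoint h := .of_nonneg hh
  set e : X := cfcₙ f h with he
  have hesa : star e = e := IsSelfAdjoint.cfcₙ
  refine ⟨e, cfcₙ_mem (hs := hS) f hmem, hesa, fun x hx => ?_⟩
  have hid : h = cfcₙ (fun t : ℝ => t) h := (cfcₙ_id' ℝ h).symm
  have e1 : cfcₙ (fun t => f t * t) h = e * h := by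
    rw [cfcₙ_mul f (fun t => t) h hfc.continuousOn hf0 continuousOn_id rfl, ← hid]
  have e2 : cfcₙ (fun t => t * f t) h = h * e := by
    rw [cfcₙ_mul (fun t => t) f h continuousOn_id rfl hfc.continuousOn hf0, ← hid]
  have e3 : cfcₙ (fun t => f t * t * f t) h = e * h * e := by
    rw [cfcₙ_mul (fun t => f t * t) f h (by fun_prop) (by simp) hfc.continuousOn hf0, e1]
  have hnorm : ‖h - e * h - h * e + e * h * e‖ ≤ ε ^ 2 := by
    have : h - e * h - h * e + e * h * e
        = cfcₙ (fun t => t - f t * t - t * f t + f t * t * f t) h := by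
      rw [cfcₙ_add _ _ h (by fun_prop) (by simp) (by fun_prop) (by simp),
        cfcₙ_sub _ _ h (by fun_prop) (by simp) (by fun_prop) (by simp),
        cfcₙ_sub _ _ h (by fun_prop) (by simp) (by fun_prop) (by simp),
        e1, e2, e3, ← hid]
    rw [this]
    refine norm_cfcₙ_le fun t ht => ?_
    have ht0 : 0 ≤ t := quasispectrum_nonneg_of_nonneg h hh t ht
    have hft : t - f t * t - t * f t + f t * t * f t = t * (1 - f t) ^ 2 := by ring
    have := hf1 t
    have := hf2 t
    rw [hft, Real.norm_of_nonneg (by positivity)]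
    rcases le_total t (ε ^ 2) with h1 | h1
    · calc t * (1 - f t) ^ 2 ≤ t * 1 := by gcongr; nlinarith
        _ ≤ ε ^ 2 := by linarith
    · rw [hf3 t h1]
      simp; positivity
  -- Formally the difference is (1 - e)(h - xx^*)(1 - e), with h - xx^* = b^*b.
  have hle : (x - e * x) * star (x - e * x) ≤ h - e * h - h * e + e * h * e := by
    rw [← sub_nonneg]
    obtain ⟨b, hb⟩ := CStarAlgebra.nonneg_iff_eq_star_mul_self.1 (sub_nonneg.2 hx)
    have : h - e * h - h * e + e * h * e - (x - e * x) * star (x - e * x)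
        = star (b - b * e) * (b - b * e) := by
      have hd : h = x * star x + star b * b := by rw [← hb]; abel
      rw [star_sub, star_mul, star_sub, star_mul, hesa, hd]
      noncomm_ring
    rw [this]
    exact star_mul_self_nonneg _
  have := CStarAlgebra.norm_le_norm_of_nonneg_of_le (mul_star_self_nonneg (x - e * x)) hle
  rw [CStarRing.norm_self_mul_star] at this
  nlinarith [norm_nonneg (x - e * x)]

/-- Approximate left units for finite families. -/
theorem exists_approx_unit_family {S : NonUnitalStarSubalgebra ℂ X} (hS : IsClosed (S : Set X))
    {ι : Type*} [Fintype ι] (c : ι → X) (hc : ∀ i, c i ∈ S) {ε : ℝ} (hε : 0 < ε) :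
    ∃ e ∈ S, star e = e ∧ ∀ i, ‖c i - e * c i‖ ≤ ε := by
  obtain ⟨e, he, hes, h⟩ := exists_approx_unit hS (h := ∑ i, c i * star (c i))
    (Finset.sum_nonneg fun i _ => mul_star_self_nonneg _)
    (sum_mem fun i _ => mul_mem (hc i) (star_mem (hc i))) hε
  exact ⟨e, he, hes, fun i => h _ (Finset.single_le_sum
    (f := fun i => c i * star (c i)) (fun i _ => mul_star_self_nonneg _) (Finset.mem_univ i))⟩

/-- A norm closed `*`-subalgebra `S` with `S X S ⊆ S` is hereditary. -/
theorem mem_of_nonneg_of_le {S : NonUnitalStarSubalgebra ℂ X} (hS : IsClosed (S : Set X))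
    (hSX : ∀ a ∈ S, ∀ x : X, ∀ b ∈ S, a * x * b ∈ S) {x y : X} (hx : 0 ≤ x) (hxy : x ≤ y)
    (hy : y ∈ S) : x ∈ S := by
  have hsq := CFC.sqrt_mul_sqrt_self x hx
  have hsa : star (CFC.sqrt x) = CFC.sqrt x := IsSelfAdjoint.of_nonneg (CFC.sqrt_nonneg x)
  set s := CFC.sqrt x
  refine hS.closure_subset_iff.2 subset_rfl (Metric.mem_closure_iff.2 fun ε hε => ?_)
  -- With s = √x, the splitting x - exe = (s - es)s + es(s - se) has norm at most δ(2‖s‖ + 1) once δ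
  -- ≤ 1.
  have hδ : 0 < min 1 (ε / (2 * (2 * ‖s‖ + 1))) := lt_min one_pos (by positivity)
  set δ := min 1 (ε / (2 * (2 * ‖s‖ + 1)))
  have hδ1 : δ ≤ 1 := min_le_left _ _
  have hδ2 : δ * (2 * ‖s‖ + 1) < ε := by
    have : δ ≤ ε / (2 * (2 * ‖s‖ + 1)) := min_le_right _ _
    rw [le_div_iff₀ (by positivity)] at this
    linarith
  obtain ⟨e, he, hes, happ⟩ := exists_approx_unit hS (hx.trans hxy) hy hδ
  have h1 : ‖s - e * s‖ ≤ δ := happ s (by rwa [hsa, hsq])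
  have h2 : ‖s - s * e‖ ≤ δ := by
    rw [← norm_star, star_sub, star_mul, hsa, hes]; exact h1
  have h3 : ‖e * s‖ ≤ ‖s‖ + 1 := by
    calc ‖e * s‖ = ‖s - (s - e * s)‖ := by rw [sub_sub_cancel]
      _ ≤ ‖s‖ + ‖s - e * s‖ := norm_sub_le _ _
      _ ≤ ‖s‖ + 1 := by linarith
  refine ⟨e * x * e, hSX e he x e he, ?_⟩
  rw [dist_eq_norm]
  calc ‖x - e * x * e‖ = ‖(s - e * s) * s + (e * s) * (s - s * e)‖ := by
        rw [← hsq]; congr 1; noncomm_ring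
    _ ≤ ‖s - e * s‖ * ‖s‖ + ‖e * s‖ * ‖s - s * e‖ :=
        (norm_add_le _ _).trans (add_le_add (norm_mul_le _ _) (norm_mul_le _ _))
    _ ≤ δ * ‖s‖ + (‖s‖ + 1) * δ := by gcongr
    _ < ε := by linarith

/-- Over positive `x`, `S` hereditary gives `a x a^* ∈ S`. -/
theorem mul_mul_mem_of_hereditary {S : NonUnitalStarSubalgebra ℂ X}
    (hS : ∀ x y : X, 0 ≤ x → x ≤ y → y ∈ S → x ∈ S) {a b : X} (ha : a ∈ S) (hb : b ∈ S) (x : X) :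
    a * x * b ∈ S := by
  have pos : ∀ x : X, 0 ≤ x → ∀ a ∈ S, a * x * star a ∈ S := fun x hx a ha =>
    hS _ (((‖x‖ : ℝ) : ℂ) • (a * star a)) (star_right_conjugate_nonneg hx a)
      (by simpa using CStarAlgebra.star_right_conjugate_le_norm_smul (a := a) (b := x)
            (.of_nonneg hx))
      (SMulMemClass.smul_mem _ (mul_mem ha (star_mem ha)))
  have hx : x ∈ Submodule.span ℂ {a : X | 0 ≤ a} := by
    rw [CStarAlgebra.span_nonneg]; trivial
  induction hx using Submodule.span_induction with
  | zero => simp [zero_mem]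
  | add x y _ _ h1 h2 => rw [mul_add, add_mul]; exact add_mem h1 h2
  | smul c x _ h => rw [mul_smul_comm, smul_mul_assoc]; exact SMulMemClass.smul_mem c h
  | mem x hx =>
    -- Polarization of the sesquilinear map (a, c) ↦ a x c^* at c = b^*.
    have h1 := pos x hx (a + star b) (add_mem ha (star_mem hb))
    have h2 := pos x hx (a - star b) (sub_mem ha (star_mem hb))
    have h3 := pos x hx (a + Complex.I • star b) (add_mem ha (SMulMemClass.smul_mem _ (star_mem hb)))
    have h4 := pos x hx (a - Complex.I • star b) (sub_mem ha (SMulMemClass.smul_mem _ (star_mem hb)))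
    have : a * x * b = (1 / 4 : ℂ) • ((a + star b) * x * star (a + star b)
        - (a - star b) * x * star (a - star b)
        + Complex.I • ((a + Complex.I • star b) * x * star (a + Complex.I • star b)
        - (a - Complex.I • star b) * x * star (a - Complex.I • star b))) := by
      simp only [star_add, star_sub, star_smul, star_star, mul_add, add_mul, mul_sub, sub_mul,
        smul_mul_assoc, mul_smul_comm, smul_add, smul_sub, smul_smul, RCLike.star_def,
        Complex.conj_I, mul_neg]
      match_scalars <;> ring_nf <;> simp only [Complex.I_sq] <;> norm_num
    rw [this]
    exact SMulMemClass.smul_mem _ (add_mem (sub_mem h1 h2) (SMulMemClass.smul_mem _ (sub_mem h3 h4)))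

end ApproximateUnit

/-! ### The F-topology on vectors and on matrices. -/

section FTopology

variable {E : Type*} [NormedAddCommGroup E] [NormedSpace ℂ E] {F : Submodule ℂ (StrongDual ℂ E)}

/-- The topologies are implicit arguments found by unification, so that `fTop F` can be used beside
the norm topology. -/
theorem continuous_comp_of {A B C : Type*} {tA : TopologicalSpace A} {tB : TopologicalSpace B}
    {tC : TopologicalSpace C} (g : B → C) (f : A → B) (hg : Continuous g) (hf : Continuous f) :
    Continuous fun x => g (f x) :=
  hg.comp hf

theorem mem_of_mem_closure {A : Type*} {t : TopologicalSpace A} {S C : Set A} (h : S ⊆ C)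
    (hC : IsClosed C) {x : A} (hx : x ∈ closure S) : x ∈ C :=
  closure_minimal h hC hx

theorem continuous_fTop_apply {φ : StrongDual ℂ E} (hφ : φ ∈ F) :
    Continuous[fTop F, inferInstance] φ :=
  continuous_comp_of (fun q : F → ℂ => q ⟨φ, hφ⟩)
    (fun (x : E) (φ : F) => (φ : StrongDual ℂ E) x) (continuous_apply _) continuous_induced_dom

theorem continuous_preTop_apply (x : E) :
    Continuous[preTop F, inferInstance] (fun φ : F => (φ : StrongDual ℂ E) x) :=
  continuous_comp_of (fun q : E → ℂ => q x) _ (continuous_apply _) continuous_induced_dom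

theorem continuous_to_fTop {T : Type*} {t : TopologicalSpace T} {f : T → E}
    (h : ∀ φ ∈ F, Continuous fun s => φ (f s)) : Continuous[t, fTop F] f :=
  continuous_induced_rng.2 (continuous_pi fun φ => h φ φ.2)

theorem continuous_id_fTop : Continuous[inferInstance, fTop F] (id : E → E) :=
  continuous_to_fTop fun φ _ => φ.continuous

theorem isClosed_of_fTop {S : Set E} (hS : IsClosed[fTop F] S) : IsClosed S :=
  @IsClosed.preimage _ _ _ (fTop F) _ continuous_id_fTop _ hS

theorem isTopologicalAddGroup_fTop : @IsTopologicalAddGroup E (fTop F) _ :=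
  topologicalAddGroup_induced (LinearMap.pi fun φ : F => ((φ : StrongDual ℂ E) : E →ₗ[ℂ] ℂ))

theorem continuousSMul_fTop : @ContinuousSMul ℂ E _ _ (fTop F) :=
  continuousSMul_induced (LinearMap.pi fun φ : F => ((φ : StrongDual ℂ E) : E →ₗ[ℂ] ℂ))

theorem isTopologicalAddGroup_fTopMat {d : ℕ} :
    @IsTopologicalAddGroup (Matrix (Fin d) (Fin d) E) (fTopMat F d) _ :=
  topologicalAddGroup_induced (LinearMap.pi fun p : F × Fin d × Fin d =>
    ((p.1 : StrongDual ℂ E) : E →ₗ[ℂ] ℂ) ∘ₗ Matrix.entryLinearMap ℂ E p.2.1 p.2.2)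

theorem continuousSMul_fTopMat {d : ℕ} :
    @ContinuousSMul ℂ (Matrix (Fin d) (Fin d) E) _ _ (fTopMat F d) :=
  continuousSMul_induced (LinearMap.pi fun p : F × Fin d × Fin d =>
    ((p.1 : StrongDual ℂ E) : E →ₗ[ℂ] ℂ) ∘ₗ Matrix.entryLinearMap ℂ E p.2.1 p.2.2)

theorem continuous_entry_fTopMat {d : ℕ} (i j : Fin d) :
    Continuous[fTopMat F d, fTop F] (fun a : Matrix (Fin d) (Fin d) E => a i j) :=
  @continuous_to_fTop _ _ _ _ _ (fTopMat F d) _ fun φ hφ =>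
    continuous_comp_of (fun q : F × Fin d × Fin d → ℂ => q (⟨φ, hφ⟩, i, j))
      (fun (a : Matrix (Fin d) (Fin d) E) (p : F × Fin d × Fin d) =>
        (p.1 : StrongDual ℂ E) (a p.2.1 p.2.2))
      (continuous_apply _) continuous_induced_dom

theorem continuous_to_fTopMat {T : Type*} {t : TopologicalSpace T} {d : ℕ}
    {f : T → Matrix (Fin d) (Fin d) E}
    (h : ∀ i j, Continuous[t, fTop F] fun s => f s i j) : Continuous[t, fTopMat F d] f :=
  continuous_induced_rng.2 (continuous_pi fun p =>
    continuous_comp_of _ _ (continuous_fTop_apply p.1.2) (h p.2.1 p.2.2))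

/-- The `F`-continuous linear functionals are the elements of `F`. -/
theorem exists_mem_of_continuous_fTop (L : E →ₗ[ℂ] ℂ) (hL : Continuous[fTop F, inferInstance] L) :
    ∃ φ ∈ F, ∀ x, φ x = L x := by
  have h := (LinearMap.mem_span_iff_continuous
    (f := fun φ : F => ((φ : StrongDual ℂ E) : E →ₗ[ℂ] ℂ)) L).2 (by
      rw [fTop, induced_to_pi] at hL
      exact hL)
  have hle : Submodule.span ℂ (Set.range fun φ : F => ((φ : StrongDual ℂ E) : E →ₗ[ℂ] ℂ)) ≤
      F.map (ContinuousLinearMap.coeLM ℂ) := by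
    rw [Submodule.span_le]
    rintro _ ⟨φ, rfl⟩
    exact ⟨φ, φ.2, rfl⟩
  obtain ⟨φ, hφ, hφL⟩ := hle h
  exact ⟨φ, hφ, fun x => by rw [← hφL]; rfl⟩

theorem IsDualPair.norm_le (hF : IsDualPair F) {x : E} {c : ℝ}
    (h : ∀ φ ∈ F, ‖φ‖ ≤ 1 → ‖φ x‖ ≤ c) : ‖x‖ ≤ c :=
  (hF.norm_eq x).2 (by rintro _ ⟨φ, hφ, h1, rfl⟩; exact h φ hφ h1)

theorem IsDualPair.ext (hF : IsDualPair F) {x y : E} (h : ∀ φ ∈ F, φ x = φ y) : x = y := by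
  refine sub_eq_zero.1 (norm_le_zero_iff.1 (hF.norm_le fun φ hφ _ => ?_))
  rw [map_sub, h φ hφ]
  simp

theorem IsDualPair.t2Space (hF : IsDualPair F) : @T2Space E (fTop F) :=
  @T2Space.of_injective_continuous _ _ (fTop F) _ _ _
    (fun _ _ h => hF.ext fun φ hφ => congrFun h ⟨φ, hφ⟩) continuous_induced_dom

/-- The norm is a supremum of F-continuous functions. This lets norm estimates survive averaging. -/
theorem IsDualPair.isClosed_closedBall (hF : IsDualPair F) (c : ℝ) :
    IsClosed[fTop F] {x : E | ‖x‖ ≤ c} := by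
  have : {x : E | ‖x‖ ≤ c} = ⋂ φ ∈ {φ : StrongDual ℂ E | φ ∈ F ∧ ‖φ‖ ≤ 1}, {x : E | ‖φ x‖ ≤ c} := by
    ext x
    simp only [Set.mem_ofPred_eq, Set.mem_iInter]
    refine ⟨fun h φ hφ => ?_, fun h => hF.norm_le fun φ h1 h2 => h φ ⟨h1, h2⟩⟩
    calc ‖φ x‖ ≤ 1 * ‖x‖ := φ.le_of_opNorm_le hφ.2 x
      _ ≤ c := by simpa using h
  rw [this]
  exact @isClosed_biInter _ _ (fTop F) _ _ fun φ hφ =>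
    @IsClosed.preimage _ _ (fTop F) _ _ (continuous_fTop_apply hφ.1) {z : ℂ | ‖z‖ ≤ c}
      (isClosed_le continuous_norm continuous_const)

/-- A continuous linear map sends the closed span of `A` into a closed submodule if it sends `A`
into it. -/
theorem map_mem_closure_of_mem_closure_span {M N : Type*} [AddCommGroup M] [Module ℂ M]
    [AddCommGroup N] [Module ℂ N] {t : TopologicalSpace M} {t' : TopologicalSpace N}
    (h1 : IsTopologicalAddGroup N) (h2 : ContinuousSMul ℂ N) (T : M →ₗ[ℂ] N) (hT : Continuous T)
    {A : Set M} {p : Submodule ℂ N} (h : ∀ a ∈ A, T a ∈ closure (p : Set N)) {x : M}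
    (hx : x ∈ closure (Submodule.span ℂ A : Set M)) : T x ∈ closure (p : Set N) := by
  have hle : Submodule.span ℂ A ≤ p.topologicalClosure.comap T := Submodule.span_le.2 h
  exact closure_minimal (s := (Submodule.span ℂ A : Set M)) (t := T ⁻¹' closure (p : Set N))
    hle (isClosed_closure.preimage hT) hx

variable (F) in
/-- The closure of a subspace in the `F`-topology. -/
noncomputable def fClosure (p : Submodule ℂ E) : Submodule ℂ E :=
  letI := fTop F
  haveI : IsTopologicalAddGroup E := isTopologicalAddGroup_fTop
  haveI : ContinuousSMul ℂ E := continuousSMul_fTop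
  p.topologicalClosure

open MeasureTheory in
/-- Weak integrals in the space of functionals. -/
theorem IsDualPair.exists_integral_dual (hF : IsDualPair F) {G : Type*} [TopologicalSpace G]
    [CompactSpace G] [MeasurableSpace G] [BorelSpace G] (μ : Measure G) [IsProbabilityMeasure μ]
    (f : G → F) (hf : ∀ x, Continuous fun g => (f g : StrongDual ℂ E) x) :
    ∃ ψ ∈ F, ∀ x, ψ x = ∫ g, (f g : StrongDual ℂ E) x ∂μ := by
  have hf' : Continuous[inferInstance, preTop F] f := continuous_induced_rng.2 (continuous_pi hf)
  have hT : @T2Space F (preTop F) :=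
    @T2Space.of_injective_continuous _ _ (preTop F) _ _ _
      (fun a b h => Subtype.ext (ContinuousLinearMap.ext fun x => congrFun h x))
      continuous_induced_dom
  have hK : RelCompact (preTop F) (Set.range f) :=
    @IsCompact.closure _ (preTop F) _ _ (@isCompact_range _ _ _ (preTop F) _ _ hf')
  have key := @exists_barycenter F _ _ (preTop F) G _ _ _ _ μ _ f hf'
  have hK' := hF.relCompact_convexHull_dual _ hK
  obtain ⟨p, _, hp⟩ := key hK'
  exact ⟨p, p.2, fun x => hp (((ContinuousLinearMap.apply ℂ ℂ x :
    StrongDual ℂ E →L[ℂ] ℂ).toLinearMap ∘ₗ F.subtype).restrictScalars ℝ)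
    (continuous_preTop_apply x)⟩

end FTopology

/-! ### The averaging projection onto the fixed point algebra. -/

section Average

open MeasureTheory

variable {X : Type*} [NonUnitalCStarAlgebra X] {G : Type*} [Group G] [TopologicalSpace G]
  {F : Submodule ℂ (StrongDual ℂ X)} {α : G →* (X ≃⋆ₐ[ℂ] X)}

theorem IsFDynamicalSystem.continuous_orbit_fTop (hα : IsFDynamicalSystem F α) (x : X) :
    Continuous[inferInstance, fTop F] fun g => α g x :=
  continuous_to_fTop fun φ hφ => hα.continuous_orbit x φ hφ

theorem IsFDynamicalSystem.exists_mem_comp (hα : IsFDynamicalSystem F α) {φ : StrongDual ℂ X}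
    (hφ : φ ∈ F) (g : G) : ∃ ψ ∈ F, ∀ x, ψ x = φ (α g x) :=
  exists_mem_of_continuous_fTop
    ((φ : X →ₗ[ℂ] ℂ) ∘ₗ ({ toFun := α g, map_add' := map_add _, map_smul' := map_smul _ } : X →ₗ[ℂ] X))
    (continuous_comp_of φ _ (continuous_fTop_apply hφ) (hα.continuous_aut g))

variable [CompactSpace G]

/-- Weak integrals of orbits. -/
theorem IsFDynamicalSystem.exists_integral (hα : IsFDynamicalSystem F α)
    [MeasurableSpace G] [BorelSpace G] (μ : Measure G) [IsProbabilityMeasure μ] (x : X) :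
    ∃ p ∈ closure[fTop F] (convexHull ℝ (Set.range fun g => α g x)),
      ∀ L : X →ₗ[ℝ] ℂ, Continuous[fTop F, inferInstance] L → L p = ∫ g, L (α g x) ∂μ := by
  have hf := hα.continuous_orbit_fTop x
  refine @exists_barycenter X _ _ (fTop F) G _ _ _ _ μ _ _ hf
    (hα.dualPair.relCompact_convexHull _ ?_)
  have := hα.dualPair.t2Space
  exact @IsCompact.closure _ (fTop F) _ _ (@isCompact_range _ _ _ (fTop F) _ _ hf)

/-- Weak integrals of orbits in the space of functionals. -/
theorem IsFDynamicalSystem.exists_integral_dual (hα : IsFDynamicalSystem F α)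
    [MeasurableSpace G] [BorelSpace G] (μ : Measure G) [IsProbabilityMeasure μ]
    {φ : StrongDual ℂ X} (hφ : φ ∈ F) :
    ∃ ψ ∈ F, ∀ x, ψ x = ∫ g, φ (α g x) ∂μ := by
  choose ψ hψ hψx using fun g => hα.exists_mem_comp hφ g
  obtain ⟨p, hp, h⟩ := hα.dualPair.exists_integral_dual μ (fun g => (⟨ψ g, hψ g⟩ : F)) fun x =>
    (hα.continuous_orbit x φ hφ).congr fun g => (hψx g x).symm
  refine ⟨p, hp, fun x => (h x).trans ?_⟩
  exact integral_congr_ae (Filter.Eventually.of_forall fun g => hψx g x)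

/-- The averaging projection onto the fixed point algebra. -/
theorem IsFDynamicalSystem.exists_average [IsTopologicalGroup G] (hα : IsFDynamicalSystem F α) :
    ∃ P : X →ₗ[ℂ] X, Continuous[fTop F, fTop F] P ∧ (∀ x, P x ∈ fixedPoints α) ∧
      (∀ C : Set X, IsClosed[fTop F] C → Convex ℝ C → ∀ x, (∀ g, α g x ∈ C) → P x ∈ C) ∧
      ∀ a ∈ fixedPoints α, ∀ b ∈ fixedPoints α, ∀ x, P (a * x * b) = a * P x * b := by
  let _ : MeasurableSpace G := borel G
  have : BorelSpace G := ⟨rfl⟩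
  let μ : Measure G := Measure.haarMeasure ⊤
  have : IsProbabilityMeasure μ := ⟨by
    have := Measure.haarMeasure_self (K₀ := (⊤ : TopologicalSpace.PositiveCompacts G))
    simpa using this⟩
  choose p hpc hp using hα.exists_integral μ
  have hpφ : ∀ φ ∈ F, ∀ x, φ (p x) = ∫ g, φ (α g x) ∂μ := fun φ hφ x =>
    hp x ((φ : X →ₗ[ℂ] ℂ).restrictScalars ℝ) (continuous_fTop_apply hφ)
  have hint : ∀ φ ∈ F, ∀ x, Integrable (fun g => φ (α g x)) μ := fun φ hφ x =>
    (hα.continuous_orbit x φ hφ).integrable_of_hasCompactSupport (HasCompactSupport.of_compactSpace _)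
  let P : X →ₗ[ℂ] X :=
    { toFun := p
      map_add' := fun x y => hα.dualPair.ext fun φ hφ => by
        rw [map_add, hpφ φ hφ, hpφ φ hφ, hpφ φ hφ,
          ← integral_add (hint φ hφ x) (hint φ hφ y)]
        simp only [map_add]
      map_smul' := fun c x => hα.dualPair.ext fun φ hφ => by
        rw [RingHom.id_apply, map_smul, hpφ φ hφ, hpφ φ hφ, ← integral_smul]
        simp only [map_smul] }
  refine ⟨P, ?_, ?_, ?_, ?_⟩
  · refine @continuous_to_fTop _ _ _ _ _ (fTop F) _ fun φ hφ => ?_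
    -- F-continuity of P means that φ ∘ P stays in F; it is the weak integral of the functionals φ ∘
    -- α_g.
    obtain ⟨ψ, hψ, hψx⟩ := hα.exists_integral_dual μ hφ
    have : (fun x => φ (P x)) = ψ := funext fun x => (hpφ φ hφ x).trans (hψx x).symm
    rw [this]
    exact continuous_fTop_apply hψ
  · intro x h
    refine hα.dualPair.ext fun φ hφ => ?_
    obtain ⟨ψ, hψ, hψx⟩ := hα.exists_mem_comp hφ h
    rw [← hψx]
    refine (hpφ ψ hψ x).trans (Eq.trans ?_ (hpφ φ hφ x).symm)
    rw [← integral_mul_left_eq_self (fun g => φ (α g x)) h]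
    simp only [hψx, map_mul, StarAlgEquiv.mul_apply]
  · intro C hC hCc x hx
    refine mem_of_mem_closure (convexHull_min ?_ hCc) hC (hpc x)
    rintro _ ⟨g, rfl⟩
    exact hx g
  · intro a ha b hb x
    refine hα.dualPair.ext fun φ hφ => ?_
    let L : X →ₗ[ℝ] ℂ := (((φ : X →ₗ[ℂ] ℂ) ∘ₗ LinearMap.mulRight ℂ b) ∘ₗ
      LinearMap.mulLeft ℂ a).restrictScalars ℝ
    have hL : Continuous[fTop F, inferInstance] L :=
      continuous_comp_of (fun x => φ (x * b)) _ (continuous_comp_of φ _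
        (continuous_fTop_apply hφ) (hα.continuous_mul_right b)) (hα.continuous_mul_left a)
    refine (hpφ φ hφ _).trans (Eq.trans ?_ (hp x L hL).symm)
    refine integral_congr_ae (Filter.Eventually.of_forall fun g => ?_)
    change φ (α g (a * x * b)) = φ (a * α g x * b)
    rw [map_mul (α g), map_mul (α g), ha g, hb g]

end Average

/-! ### Fixed approximate units and the ideal generated by fixed points of Y. -/

section Fixed

variable {X : Type*} [NonUnitalCStarAlgebra X] {G : Type*} [Group G] [TopologicalSpace G]
  {F : Submodule ℂ (StrongDual ℂ X)} {α : G →* (X ≃⋆ₐ[ℂ] X)}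

omit [TopologicalSpace G] in
theorem mul_mem_fixedPoints {a b : X} (ha : a ∈ fixedPoints α) (hb : b ∈ fixedPoints α) :
    a * b ∈ fixedPoints α := fun g => by rw [map_mul, ha g, hb g]

omit [TopologicalSpace G] in
theorem star_mem_fixedPoints {a : X} (ha : a ∈ fixedPoints α) : star a ∈ fixedPoints α :=
  fun g => by rw [map_star, ha g]

theorem IsFDynamicalSystem.isClosed_fixedPoints (hα : IsFDynamicalSystem F α) :
    IsClosed[fTop F] (fixedPoints α) := by
  have hT := hα.dualPair.t2Space
  have : fixedPoints α = ⋂ g, {x | α g x = id x} := by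
    ext x; simp [fixedPoints]
  rw [this]
  exact @isClosed_iInter _ _ (fTop F) _ fun g =>
    @isClosed_eq _ _ (fTop F) (fTop F) hT _ _ (hα.continuous_aut g) (@continuous_id _ (fTop F))

/-- The linear map `x ↦ a x b`. -/
def sandwichMap (a b : X) : X →ₗ[ℂ] X := LinearMap.mulRight ℂ b ∘ₗ LinearMap.mulLeft ℂ a

@[simp] theorem sandwichMap_apply (a b x : X) : sandwichMap a b x = a * x * b := rfl

theorem IsFDynamicalSystem.continuous_sandwichMap (hα : IsFDynamicalSystem F α) (a b : X) :
    Continuous[fTop F, fTop F] (sandwichMap a b) :=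
  continuous_comp_of (fun x => x * b) _ (hα.continuous_mul_right b) (hα.continuous_mul_left a)

theorem continuous_mapMatrix {d : ℕ} {T : X →ₗ[ℂ] X}
    (hT : Continuous[fTop F, fTop F] T) :
    Continuous[fTopMat F d, fTopMat F d] (fun a : Matrix (Fin d) (Fin d) X => a.map T) :=
  @continuous_to_fTopMat _ _ _ _ _ (fTopMat F d) _ _ fun i j =>
    continuous_comp_of T (fun a : Matrix (Fin d) (Fin d) X => a i j) hT
      (continuous_entry_fTopMat i j)

theorem isClosed_matrix {d : ℕ} {S : Set X} (hS : IsClosed[fTop F] S) :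
    IsClosed[fTopMat F d] {a : Matrix (Fin d) (Fin d) X | ∀ i j, a i j ∈ S} := by
  have : {a : Matrix (Fin d) (Fin d) X | ∀ i j, a i j ∈ S} =
      ⋂ i, ⋂ j, (fun a : Matrix (Fin d) (Fin d) X => a i j) ⁻¹' S := by
    ext a; simp
  rw [this]
  exact @isClosed_iInter _ _ (fTopMat F d) _ fun i => @isClosed_iInter _ _ (fTopMat F d) _ fun j =>
    @IsClosed.preimage _ _ (fTopMat F d) (fTop F) _ (continuous_entry_fTopMat i j) _ hS

/-- Entrywise norm limits stay in `F`-closed sets of matrices. -/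
theorem mem_of_approx {d : ℕ} {W : Set (Matrix (Fin d) (Fin d) X)} (hW : IsClosed[fTopMat F d] W)
    {a : Matrix (Fin d) (Fin d) X} (h : ∀ ε > 0, ∃ b ∈ W, ∀ i j, ‖a i j - b i j‖ ≤ ε) : a ∈ W := by
  have hid : Continuous[inferInstance, fTopMat F d] (id : Matrix (Fin d) (Fin d) X → _) :=
    continuous_to_fTopMat fun i j => continuous_to_fTop fun φ _ =>
      φ.continuous.comp ((continuous_apply j).comp (continuous_apply i))
  have hW' : IsClosed W := @IsClosed.preimage _ _ _ (fTopMat F d) _ hid _ hW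
  choose b hb hab using fun n : ℕ => h (1 / ((n : ℝ) + 1)) (by positivity)
  refine hW'.mem_of_tendsto (f := b) (b := Filter.atTop) ?_ (Filter.Eventually.of_forall hb)
  refine tendsto_pi_nhds.2 fun i => tendsto_pi_nhds.2 fun j => ?_
  refine tendsto_iff_norm_sub_tendsto_zero.2 (squeeze_zero (fun _ => norm_nonneg _) (fun n => ?_)
    tendsto_one_div_add_atTop_nhds_zero_nat)
  rw [norm_sub_rev]
  exact hab n i j

theorem continuous_const_sub {M N : Type*} [AddCommGroup N] {t : TopologicalSpace M}
    {t' : TopologicalSpace N} (_ : IsTopologicalAddGroup N) (c : N) {f : M → N}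
    (hf : Continuous f) : Continuous fun x => c - f x :=
  continuous_const.sub hf

theorem mem_of_approx_norm {S : Set X} (hS : IsClosed S) {x : X}
    (h : ∀ ε > 0, ∃ y ∈ S, ‖x - y‖ ≤ ε) : x ∈ S := by
  refine hS.closure_subset_iff.2 subset_rfl (Metric.mem_closure_iff.2 fun ε hε => ?_)
  obtain ⟨y, hy, hxy⟩ := h (ε / 2) (by positivity)
  exact ⟨y, hy, by rw [dist_eq_norm]; linarith⟩

/-- The fixed point algebra as a `*`-subalgebra. -/
def fixedSubalgebra (α : G →* (X ≃⋆ₐ[ℂ] X)) : NonUnitalStarSubalgebra ℂ X where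
  carrier := fixedPoints α
  add_mem' := fun ha hb g => by rw [map_add, ha g, hb g]
  zero_mem' := fun g => map_zero _
  mul_mem' := mul_mem_fixedPoints
  smul_mem' := fun c x hx g => by rw [map_smul, hx g]
  star_mem' := star_mem_fixedPoints

/-- The `F`-closed ideal of `X^α` generated by the fixed point algebra of `Y`. -/
noncomputable def fixedIdeal (F : Submodule ℂ (StrongDual ℂ X)) (α : G →* (X ≃⋆ₐ[ℂ] X))
    (Y : NonUnitalStarSubalgebra ℂ X) : Submodule ℂ X :=
  fClosure F (Submodule.span ℂ {z | ∃ a ∈ fixedPoints α, ∃ y ∈ fixedPoints α, ∃ y' ∈ fixedPoints α,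
    ∃ b ∈ fixedPoints α, y ∈ Y ∧ y' ∈ Y ∧ z = a * y * (y' * b)})

theorem IsFDynamicalSystem.isFClosedIdeal_fixedIdeal (hα : IsFDynamicalSystem F α)
    (Y : NonUnitalStarSubalgebra ℂ X) : IsFClosedIdeal F α (fixedIdeal F α Y) where
  subset := by
    have hle : Submodule.span ℂ {z | ∃ a ∈ fixedPoints α, ∃ y ∈ fixedPoints α,
        ∃ y' ∈ fixedPoints α, ∃ b ∈ fixedPoints α, y ∈ Y ∧ y' ∈ Y ∧ z = a * y * (y' * b)} ≤
        (fixedSubalgebra α).toSubmodule := by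
      rw [Submodule.span_le]
      rintro _ ⟨a, ha, y, hy, y', hy', b, hb, -, -, rfl⟩
      exact mul_mem_fixedPoints (mul_mem_fixedPoints ha hy) (mul_mem_fixedPoints hy' hb)
    exact fun x hx => mem_of_mem_closure hle hα.isClosed_fixedPoints hx
  mul_left_mem := fun c hc x hx => by
    refine map_mem_closure_of_mem_closure_span isTopologicalAddGroup_fTop continuousSMul_fTop
      (LinearMap.mulLeft ℂ c) (hα.continuous_mul_left c) ?_ hx
    rintro _ ⟨a, ha, y, hy, y', hy', b, hb, h, h', rfl⟩
    refine @subset_closure _ (fTop F) _ _ (Submodule.subset_span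
      ⟨c * a, mul_mem_fixedPoints hc ha, y, hy, y', hy', b, hb, h, h', ?_⟩)
    simp [mul_assoc]
  mul_right_mem := fun c hc x hx => by
    refine map_mem_closure_of_mem_closure_span isTopologicalAddGroup_fTop continuousSMul_fTop
      (LinearMap.mulRight ℂ c) (hα.continuous_mul_right c) ?_ hx
    rintro _ ⟨a, ha, y, hy, y', hy', b, hb, h, h', rfl⟩
    refine @subset_closure _ (fTop F) _ _ (Submodule.subset_span
      ⟨a, ha, y, hy, y', hy', b * c, mul_mem_fixedPoints hb hc, h, h', ?_⟩)
    simp [mul_assoc]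
  isClosed := @isClosed_closure _ (fTop F) _

variable [PartialOrder X] [StarOrderedRing X]

/-- A finite family of elements of `Y` whose span is invariant under `α`, with uniformly bounded
coefficients, has approximate left units in the fixed point algebra of `Y`. -/
theorem IsFDynamicalSystem.exists_fixed_approx_unit [IsTopologicalGroup G] [CompactSpace G]
    (hα : IsFDynamicalSystem F α) {Y : NonUnitalStarSubalgebra ℂ X}
    (hY : IsClosed[fTop F] (Y : Set X)) (hinv : ∀ g, ∀ y ∈ Y, α g y ∈ Y)
    {ι : Type*} [Fintype ι] (c : ι → X) (hc : ∀ i, c i ∈ Y) (u : G → ι → ι → ℂ)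
    (hu : ∀ g i k, ‖u g i k‖ ≤ 1) (huc : ∀ g i, α g (c i) = ∑ k, u g i k • c k)
    {ε : ℝ} (hε : 0 < ε) :
    ∃ e ∈ Y, e ∈ fixedPoints α ∧ ∀ i, ‖c i - e * c i‖ ≤ ε := by
  obtain ⟨P, -, hfix, hconv, -⟩ := hα.exists_average
  obtain ⟨e, he, -, happ⟩ := exists_approx_unit_family (isClosed_of_fTop hY) c hc
    (ε := ε / (Fintype.card ι + 1)) (by positivity)
  refine ⟨P e, hconv Y hY ?_ e fun g => hinv g e he, hfix e, fun i => ?_⟩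
  · exact (Y.toSubmodule.restrictScalars ℝ).convex
  -- The elements z with ‖c_i - z c_i‖ ≤ ε form an F-closed convex set, so P e belongs to it once
  -- every α_g(e) does.
  have hcl : IsClosed[fTop F] {z : X | ‖c i - z * c i‖ ≤ ε} := by
    exact @IsClosed.preimage _ _ (fTop F) (fTop F) _
      (continuous_const_sub isTopologicalAddGroup_fTop (c i) (hα.continuous_mul_right (c i))) _
      (hα.dualPair.isClosed_closedBall ε)
  refine hconv _ hcl ?_ e fun g => ?_
  · intro x hx y hy s t hs ht hst
    have : c i - (s • x + t • y) * c i = s • (c i - x * c i) + t • (c i - y * c i) := by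
      rw [add_mul, smul_mul_assoc, smul_mul_assoc, smul_sub, smul_sub]
      nth_rewrite 1 [← one_smul ℝ (c i)]
      rw [← hst, add_smul]
      abel
    change ‖_‖ ≤ ε
    rw [this]
    refine (norm_add_le _ _).trans ?_
    rw [norm_smul, norm_smul, Real.norm_of_nonneg hs, Real.norm_of_nonneg ht]
    calc s * ‖c i - x * c i‖ + t * ‖c i - y * c i‖ ≤ s * ε + t * ε := by
          gcongr
          · exact hx
          · exact hy
      _ = ε := by rw [← add_mul, hst, one_mul]
  · change ‖c i - α g e * c i‖ ≤ ε
    -- Pulling back by g moves the error to (1 - e)α_{g⁻¹}(c_i), a combination of the card ι errors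
    -- c_k - e c_k; this explains the initial tolerance.
    have h1 : c i - α g e * c i = α g (∑ k, u g⁻¹ i k • (c k - e * c k)) := by
      have h2 : α g (α g⁻¹ (c i)) = c i := by
        rw [← StarAlgEquiv.mul_apply, ← map_mul]; simp
      have : ∑ k, u g⁻¹ i k • (c k - e * c k) = α g⁻¹ (c i) - e * α g⁻¹ (c i) := by
        simp only [smul_sub, Finset.sum_sub_distrib, huc, Finset.mul_sum, mul_smul_comm]
      rw [this, map_sub, map_mul, h2]
    rw [h1, StarAlgEquiv.norm_map]
    calc ‖∑ k, u g⁻¹ i k • (c k - e * c k)‖ ≤ ∑ k : ι, ε / (Fintype.card ι + 1) := by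
          refine norm_sum_le_of_le _ fun k _ => ?_
          rw [norm_smul]
          calc _ ≤ 1 * (ε / (Fintype.card ι + 1)) :=
                mul_le_mul (hu _ _ _) (happ k) (norm_nonneg _) zero_le_one
            _ = _ := one_mul _
      _ ≤ ε := by
          rw [Finset.sum_const, Finset.card_univ, nsmul_eq_mul, mul_div_assoc',
            div_le_iff₀ (by positivity)]
          nlinarith

theorem mul_mem_of_forall_mul_mem {S : NonUnitalStarSubalgebra ℂ X} (hS : IsClosed (S : Set X))
    {J : Set X} (hJ : IsClosed J) (w : X) {y : X} (hy : y ∈ S) (h : ∀ e ∈ S, w * (y * e) ∈ J) :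
    w * y ∈ J := by
  refine mem_of_approx_norm hJ fun ε hε => ?_
  obtain ⟨e, he, hes, happ⟩ := exists_approx_unit_family hS (fun _ : Unit => star y)
    (fun _ => star_mem hy) (ε := ε / (‖w‖ + 1)) (by positivity)
  refine ⟨_, h e he, ?_⟩
  have h1 : ‖y - y * e‖ ≤ ε / (‖w‖ + 1) := by
    rw [← norm_star, star_sub, star_mul, hes]; exact happ ()
  calc ‖w * y - w * (y * e)‖ = ‖w * (y - y * e)‖ := by rw [mul_sub]
    _ ≤ ‖w‖ * (ε / (‖w‖ + 1)) := (norm_mul_le _ _).trans (by gcongr)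
    _ ≤ ε := by
      rw [mul_div_assoc', div_le_iff₀ (by positivity)]
      nlinarith [norm_nonneg w]

theorem mem_of_forall_mul_mem {S : NonUnitalStarSubalgebra ℂ X} (hS : IsClosed (S : Set X))
    {J : Set X} (hJ : IsClosed J) {y : X} (hy : y ∈ S) (h : ∀ e ∈ S, e * y ∈ J) : y ∈ J := by
  refine mem_of_approx_norm hJ fun ε hε => ?_
  obtain ⟨e, he, hes, happ⟩ := exists_approx_unit_family hS (fun _ : Unit => y) (fun _ => hy) hε
  exact ⟨_, h e he, happ ()⟩

/-- Approximate units of Y ∩ X^α, inserted one at a time, turn y into a generator: y ≈ ay ≈ ayy' ≈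
ayy'b. -/
theorem IsFDynamicalSystem.mem_fixedIdeal (hα : IsFDynamicalSystem F α)
    {Y : NonUnitalStarSubalgebra ℂ X} (hY : IsClosed[fTop F] (Y : Set X)) {y : X} (hy : y ∈ Y)
    (hyα : y ∈ fixedPoints α) : y ∈ fixedIdeal F α Y := by
  have hS : IsClosed ((Y ⊓ fixedSubalgebra α : NonUnitalStarSubalgebra ℂ X) : Set X) :=
    (isClosed_of_fTop hY).inter (isClosed_of_fTop hα.isClosed_fixedPoints)
  have hJ : IsClosed (fixedIdeal F α Y : Set X) :=
    isClosed_of_fTop (hα.isFClosedIdeal_fixedIdeal Y).isClosed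
  refine mem_of_forall_mul_mem hS hJ (y := y) ⟨hy, hyα⟩ fun a ha => ?_
  refine mul_mem_of_forall_mul_mem hS hJ a (y := y) ⟨hy, hyα⟩ fun y' hy' => ?_
  rw [← mul_assoc]
  refine mul_mem_of_forall_mul_mem hS hJ (a * y) hy' fun b hb => ?_
  exact @subset_closure _ (fTop F) _ _ (Submodule.subset_span
    ⟨a, ha.2, y, hyα, y', hy'.2, b, hb.2, hy, hy'.1, rfl⟩)

end Fixed

/-! ### The hereditary subalgebra generated by an ideal of fixed points. -/

section Sandwich

variable {X : Type*} [NonUnitalCStarAlgebra X] {G : Type*} [Group G] [TopologicalSpace G]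
  {F : Submodule ℂ (StrongDual ℂ X)} {α : G →* (X ≃⋆ₐ[ℂ] X)} {J : Submodule ℂ X}

theorem mul_mem_sandwich {j k : X} (hj : j ∈ J) (hk : k ∈ J) (x : X) : j * x * k ∈ sandwich F J :=
  @subset_closure _ (fTop F) _ _ (Submodule.subset_span ⟨j, hj, x, k, hk, rfl⟩)

theorem isClosed_sandwich : IsClosed[fTop F] (sandwich F J) := @isClosed_closure _ (fTop F) _

/-- A linear `F`-continuous map that preserves the generators preserves the sandwich. -/
theorem map_mem_sandwich {T : X →ₗ[ℂ] X} (hT : Continuous[fTop F, fTop F] T)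
    (h : ∀ j ∈ J, ∀ x, ∀ k ∈ J, T (j * x * k) ∈ sandwich F J) {x : X} (hx : x ∈ sandwich F J) :
    T x ∈ sandwich F J := by
  refine map_mem_closure_of_mem_closure_span isTopologicalAddGroup_fTop continuousSMul_fTop
    T hT ?_ hx
  rintro _ ⟨j, hj, x, k, hk, rfl⟩
  exact h j hj x k hk

/-- Separate continuity suffices, since the closure is taken in one variable at a time. -/
theorem map_mem_sandwich₂ {f : X →ₗ[ℂ] X →ₗ[ℂ] X} (h1 : ∀ x, Continuous[fTop F, fTop F] (f x))
    (h2 : ∀ y, Continuous[fTop F, fTop F] fun x => f x y)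
    (h : ∀ j ∈ J, ∀ x, ∀ k ∈ J, ∀ j' ∈ J, ∀ x', ∀ k' ∈ J,
      f (j * x * k) (j' * x' * k') ∈ sandwich F J)
    {x y : X} (hx : x ∈ sandwich F J) (hy : y ∈ sandwich F J) : f x y ∈ sandwich F J :=
  map_mem_sandwich (T := f.flip y) (h2 y)
    (fun j hj x k hk => map_mem_sandwich (h1 _) (fun j' hj' x' k' hk' =>
      h j hj x k hk j' hj' x' k' hk') hy) hx

theorem IsFDynamicalSystem.mul_mul_mem_sandwich (hα : IsFDynamicalSystem F α) {x y : X}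
    (hx : x ∈ sandwich F J) (hy : y ∈ sandwich F J) (w : X) : x * w * y ∈ sandwich F J :=
  map_mem_sandwich₂ (f := LinearMap.mul ℂ X ∘ₗ LinearMap.mulRight ℂ w)
    (fun x => hα.continuous_mul_left (x * w))
    (fun y => continuous_comp_of (fun x => x * y) _ (hα.continuous_mul_right y)
      (hα.continuous_mul_right w))
    (fun j hj x k hk j' hj' x' k' hk' => by
      change j * x * k * w * (j' * x' * k') ∈ sandwich F J
      have : j * x * k * w * (j' * x' * k') = j * (x * k * w * j' * x') * k' := by
        simp only [mul_assoc]
      rw [this]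
      exact mul_mem_sandwich hj hk' _) hx hy

theorem IsFDynamicalSystem.mul_mem_sandwich_of_mem (hα : IsFDynamicalSystem F α) {x y : X}
    (hx : x ∈ sandwich F J) (hy : y ∈ sandwich F J) : x * y ∈ sandwich F J :=
  map_mem_sandwich₂ (f := LinearMap.mul ℂ X) (fun x => hα.continuous_mul_left x)
    (fun y => hα.continuous_mul_right y)
    (fun j hj x k hk j' hj' x' k' hk' => by
      change j * x * k * (j' * x' * k') ∈ sandwich F J
      have : j * x * k * (j' * x' * k') = j * (x * k * j' * x') * k' := by
        simp only [mul_assoc]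
      rw [this]
      exact mul_mem_sandwich hj hk' _) hx hy

theorem IsFDynamicalSystem.aut_mem_sandwich (hα : IsFDynamicalSystem F α)
    (hJ : (J : Set X) ⊆ fixedPoints α) (g : G) {x : X} (hx : x ∈ sandwich F J) :
    α g x ∈ sandwich F J := by
  refine map_mem_sandwich
    (T := { toFun := α g, map_add' := map_add _, map_smul' := map_smul _ })
    (hα.continuous_aut g) (fun j hj x k hk => ?_) hx
  change α g (j * x * k) ∈ _
  rw [map_mul, map_mul, hJ hj g, hJ hk g]
  exact mul_mem_sandwich hj hk _

theorem IsFDynamicalSystem.star_mem_sandwich (hα : IsFDynamicalSystem F α)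
    (hJ : ∀ j ∈ J, star j ∈ J) {x : X} (hx : x ∈ sandwich F J) : star x ∈ sandwich F J := by
  have hle : (Submodule.span ℂ {z : X | ∃ j ∈ J, ∃ x : X, ∃ k ∈ J, z = j * x * k} : Set X) ⊆
      star ⁻¹' sandwich F J := by
    intro z hz
    change star z ∈ fClosure F _
    induction hz using Submodule.span_induction with
    | zero => rw [star_zero]; exact zero_mem _
    | add x y _ _ h1 h2 => rw [star_add]; exact add_mem h1 h2
    | smul c x _ h => rw [star_smul]; exact Submodule.smul_mem _ _ h
    | mem z hz =>
      obtain ⟨j, hj, x, k, hk, rfl⟩ := hz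
      have := mul_mem_sandwich (F := F) (hJ k hk) (hJ j hj) (star x)
      rw [star_mul, star_mul, ← mul_assoc]
      exact this
  exact mem_of_mem_closure hle
    (@IsClosed.preimage _ _ (fTop F) (fTop F) _ hα.continuous_star _ isClosed_sandwich) hx

/-- The sandwich as a `*`-subalgebra. -/
theorem IsFDynamicalSystem.exists_coe_eq_sandwich (hα : IsFDynamicalSystem F α)
    (hJ : ∀ j ∈ J, star j ∈ J) :
    ∃ Z : NonUnitalStarSubalgebra ℂ X, (Z : Set X) = sandwich F J :=
  ⟨{ fClosure F (Submodule.span ℂ {z : X | ∃ j ∈ J, ∃ x : X, ∃ k ∈ J, z = j * x * k}) with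
      mul_mem' := fun hx hy => hα.mul_mem_sandwich_of_mem hx hy
      star_mem' := fun hx => hα.star_mem_sandwich hJ hx }, rfl⟩

/-- Fixed points of the sandwich belong to the ideal. -/
theorem IsFDynamicalSystem.mem_of_mem_sandwich [IsTopologicalGroup G] [CompactSpace G]
    (hα : IsFDynamicalSystem F α) (hJ : IsFClosedIdeal F α J) {z : X} (hz : z ∈ sandwich F J)
    (hzα : z ∈ fixedPoints α) : z ∈ J := by
  obtain ⟨P, hPc, hfix, hconv, hmul⟩ := hα.exists_average
  have hPz : P z = z := by
    have hT := hα.dualPair.t2Space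
    exact hconv {z} (@isClosed_singleton _ (fTop F) _ z) (convex_singleton z) z fun g => hzα g
  rw [← hPz]
  have hle : Submodule.span ℂ {z : X | ∃ j ∈ J, ∃ x : X, ∃ k ∈ J, z = j * x * k} ≤ J.comap P := by
    rw [Submodule.span_le]
    rintro _ ⟨j, hj, x, k, hk, rfl⟩
    change P (j * x * k) ∈ J
    -- P(jxk) = jP(x)k, and P(x) is fixed, so the ideal property applies.
    rw [hmul j (hJ.subset hj) k (hJ.subset hk)]
    exact hJ.mul_left_mem _ (mul_mem_fixedPoints (hJ.subset hj) (hfix x)) _ hk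
  exact mem_of_mem_closure (C := P ⁻¹' J) hle
    (@IsClosed.preimage _ _ (fTop F) (fTop F) _ hPc _ hJ.isClosed) hz

variable [PartialOrder X] [StarOrderedRing X]

omit [TopologicalSpace G] in
/-- Closed two-sided ideals of the fixed point algebra are self-adjoint. -/
theorem IsFClosedIdeal.star_mem (hJ : IsFClosedIdeal F α J) {j : X} (hj : j ∈ J) : star j ∈ J := by
  have hcl := isClosed_of_fTop hJ.isClosed
  -- J ∩ J^* contains jj^*, hence approximate units e with j^*e → j^*; each j^*e lies in J.
  let S : NonUnitalStarSubalgebra ℂ X :=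
    { carrier := {x | x ∈ J ∧ star x ∈ J}
      add_mem' := fun ha hb => ⟨add_mem ha.1 hb.1, by rw [star_add]; exact add_mem ha.2 hb.2⟩
      zero_mem' := ⟨zero_mem _, by rw [star_zero]; exact zero_mem _⟩
      mul_mem' := fun ha hb => ⟨hJ.mul_left_mem _ (hJ.subset ha.1) _ hb.1, by
        rw [star_mul]; exact hJ.mul_left_mem _ (hJ.subset hb.2) _ ha.2⟩
      smul_mem' := fun c x hx => ⟨J.smul_mem c hx.1, by
        rw [star_smul]; exact J.smul_mem _ hx.2⟩
      star_mem' := fun hx => ⟨hx.2, by rw [star_star]; exact hx.1⟩ }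
  have hS : IsClosed (S : Set X) := hcl.inter (hcl.preimage continuous_star)
  have hjs := star_mem_fixedPoints (hJ.subset hj)
  have hmem : j * star j ∈ J := hJ.mul_right_mem _ hjs _ hj
  refine mem_of_approx_norm hcl fun ε hε => ?_
  obtain ⟨e, he, hes, happ⟩ := exists_approx_unit hS (mul_star_self_nonneg j)
    ⟨hmem, by rwa [star_mul, star_star]⟩ hε
  refine ⟨star j * e, hJ.mul_left_mem _ hjs _ he.1, ?_⟩
  rw [← norm_star, star_sub, star_mul, star_star, hes]
  exact happ j le_rfl

/-- The sandwich of a non-zero ideal is an invariant hereditary subalgebra. -/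
theorem IsFDynamicalSystem.exists_isInvariantHereditary_sandwich (hα : IsFDynamicalSystem F α)
    (hJ : IsFClosedIdeal F α J) (hne : J ≠ ⊥) :
    ∃ Z : NonUnitalStarSubalgebra ℂ X, (Z : Set X) = sandwich F J ∧
      IsInvariantHereditary F α Z := by
  obtain ⟨Z, hZ⟩ := hα.exists_coe_eq_sandwich (F := F) fun j hj => hJ.star_mem hj
  have hmem : ∀ x, x ∈ Z ↔ x ∈ sandwich F J := fun x => by rw [← hZ]; rfl
  have hcl : IsClosed[fTop F] (Z : Set X) := by rw [hZ]; exact isClosed_sandwich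
  refine ⟨Z, hZ, ?_, hcl, fun g => ?_, fun x y hx hxy hy => ?_⟩
  · obtain ⟨j, hj, hj0⟩ := J.exists_mem_ne_zero_of_ne_bot hne
    refine ⟨j * star j * j, (hmem _).2 (mul_mem_sandwich hj hj _), fun h0 => hj0 ?_⟩
    have h1 : star (star j * j) * (star j * j) = 0 := by
      have : star (star j * j) * (star j * j) = star j * (j * star j * j) := by
        rw [star_mul, star_star]; simp only [mul_assoc]
      rw [this, h0, mul_zero]
    exact CStarRing.star_mul_self_eq_zero_iff _ |>.1 (CStarRing.star_mul_self_eq_zero_iff _ |>.1 h1)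
  · refine Set.Subset.antisymm ?_ fun x hx => ⟨α g⁻¹ x, ?_, ?_⟩
    · rintro _ ⟨x, hx, rfl⟩
      exact (hmem _).2 (hα.aut_mem_sandwich hJ.subset g ((hmem _).1 hx))
    · exact (hmem _).2 (hα.aut_mem_sandwich hJ.subset g⁻¹ ((hmem _).1 hx))
    · change α g (α g⁻¹ x) = x
      rw [← StarAlgEquiv.mul_apply, ← map_mul]; simp
  · exact mem_of_nonneg_of_le (isClosed_of_fTop hcl) (fun a ha w b hb =>
      (hmem _).2 (hα.mul_mul_mem_sandwich ((hmem _).1 ha) ((hmem _).1 hb) w)) hx hxy hy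

end Sandwich

/-! ### Spectral subspaces and the comparison of Y with the sandwich. -/

section Spectral

variable {X : Type*} [NonUnitalCStarAlgebra X] {G : Type*} [Group G] [TopologicalSpace G]
  {F : Submodule ℂ (StrongDual ℂ X)} {α : G →* (X ≃⋆ₐ[ℂ] X)} {π : UnitaryIrrep G}

theorem continuous_sum_of {A ι : Type*} [Fintype ι] {t : TopologicalSpace A} {f : ι → A → ℂ}
    (h : ∀ k, Continuous (f k)) : Continuous fun x => ∑ k, f k x :=
  continuous_finsetSum _ fun k _ => h k

theorem continuous_const_mul_of {A : Type*} {t : TopologicalSpace A} {f : A → ℂ} (c : ℂ)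
    (h : Continuous f) : Continuous fun x => c • f x :=
  h.const_smul c

theorem UnitaryIrrep.norm_coeff_le (π : UnitaryIrrep G) (g : G) (i j : Fin π.dim) :
    ‖π.coeff g i j‖ ≤ 1 :=
  entry_norm_bound_of_unitary (π.mat g).2 i j

theorem UnitaryIrrep.coeff_inv (π : UnitaryIrrep G) (g : G) (i j : Fin π.dim) :
    π.coeff g⁻¹ i j = star (π.coeff g j i) := by
  unfold UnitaryIrrep.coeff
  rw [map_inv]
  rfl

theorem UnitaryIrrep.sum_coeff_mul_coeff_inv (π : UnitaryIrrep G) (g : G) (i j : Fin π.dim) :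
    ∑ k, π.coeff g i k * π.coeff g⁻¹ k j = if i = j then 1 else 0 := by
  have h : (π.mat g).1 * (π.mat g⁻¹).1 = 1 := by
    have : π.mat g * π.mat g⁻¹ = 1 := by rw [← map_mul]; simp
    exact congrArg Subtype.val this
  have h2 := congrFun (congrFun h i) j
  rw [Matrix.mul_apply, Matrix.one_apply] at h2
  exact h2

/-- Y and Z are unrelated here: this is how spectral matrices over the sandwich are cut down to Y.
-/
theorem mem_spectralSubspace_map {Y Z : Set X} {a : Matrix (Fin π.dim) (Fin π.dim) X}
    (ha : a ∈ spectralSubspace α Z π) {s t : X} (hs : s ∈ fixedPoints α) (ht : t ∈ fixedPoints α)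
    (h : ∀ i j, s * a i j * t ∈ Y) : a.map (sandwichMap s t) ∈ spectralSubspace α Y π := by
  refine ⟨h, fun g i j => ?_⟩
  simp only [Matrix.map_apply, sandwichMap_apply]
  rw [map_mul, map_mul, hs g, ht g, ha.2 g i j, Finset.mul_sum, Finset.sum_mul]
  simp only [mul_smul_comm, smul_mul_assoc]

theorem mem_adFixedPoints_map {Y Z : Set X} {a : Matrix (Fin π.dim) (Fin π.dim) X}
    (ha : a ∈ adFixedPoints α Z π) {T : X →ₗ[ℂ] X} (hT : ∀ g x, α g (T x) = T (α g x))
    (h : ∀ i j, T (a i j) ∈ Y) : a.map T ∈ adFixedPoints α Y π := by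
  refine ⟨h, fun g i j => ?_⟩
  simp only [Matrix.map_apply]
  rw [← ha.2 g i j, map_sum]
  refine Finset.sum_congr rfl fun k _ => ?_
  rw [map_sum]
  refine Finset.sum_congr rfl fun l _ => ?_
  rw [map_smul, hT]

/-- Solving the fixed point relation for α_g shows that the entries span an invariant space, as
`exists_fixed_approx_unit` requires. -/
theorem aut_apply_of_mem_adFixedPoints {Y : Set X} {a : Matrix (Fin π.dim) (Fin π.dim) X}
    (ha : a ∈ adFixedPoints α Y π) (g : G) (i j : Fin π.dim) :
    α g (a i j) = ∑ k, ∑ l, (π.coeff g⁻¹ i k * π.coeff g l j) • a k l := by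
  have h := congrArg (α g) (ha.2 g⁻¹ i j)
  rw [← h, map_sum]
  refine Finset.sum_congr rfl fun k _ => ?_
  rw [map_sum]
  refine Finset.sum_congr rfl fun l _ => ?_
  rw [map_smul, inv_inv, ← StarAlgEquiv.mul_apply, ← map_mul]
  simp

theorem conjTranspose_mul_mem_adFixedPoints {Y : NonUnitalStarSubalgebra ℂ X}
    {a b : Matrix (Fin π.dim) (Fin π.dim) X} (ha : a ∈ spectralSubspace α (Y : Set X) π)
    (hb : b ∈ spectralSubspace α (Y : Set X) π) :
    a.conjTranspose * b ∈ adFixedPoints α (Y : Set X) π := by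
  refine ⟨fun i j => ?_, fun g i j => ?_⟩
  · rw [Matrix.mul_apply]
    exact sum_mem fun k _ => mul_mem (star_mem (ha.1 k i)) (hb.1 k j)
  simp only [Matrix.mul_apply, Matrix.conjTranspose_apply]
  have h1 : ∀ m, ∑ k, π.coeff g i k • star (α g (a m k)) = star (a m i) := fun m => by
    simp only [ha.2, star_sum, star_smul, Finset.smul_sum, smul_smul]
    rw [Finset.sum_comm]
    simp only [← UnitaryIrrep.coeff_inv, ← Finset.sum_smul, π.sum_coeff_mul_coeff_inv, ite_smul,
      one_smul, zero_smul, Finset.sum_ite_eq, Finset.mem_univ, if_true]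
  have h2 : ∀ m, ∑ l, π.coeff g⁻¹ l j • α g (b m l) = b m j := fun m => by
    simp only [hb.2, Finset.smul_sum, smul_smul]
    rw [Finset.sum_comm]
    simp only [mul_comm (π.coeff g⁻¹ _ _), ← Finset.sum_smul, π.sum_coeff_mul_coeff_inv, ite_smul,
      one_smul, zero_smul, Finset.sum_ite_eq', Finset.mem_univ, if_true]
  calc ∑ k, ∑ l, (π.coeff g i k * π.coeff g⁻¹ l j) • α g (∑ m, star (a m k) * b m l)
      = ∑ k, ∑ l, ∑ m, (π.coeff g i k • star (α g (a m k))) * (π.coeff g⁻¹ l j • α g (b m l)) := by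
        simp only [map_sum, map_mul, map_star, Finset.smul_sum, smul_mul_smul_comm]
    _ = ∑ m, (∑ k, π.coeff g i k • star (α g (a m k))) * ∑ l, π.coeff g⁻¹ l j • α g (b m l) := by
        simp only [Finset.sum_mul_sum]
        symm
        rw [Finset.sum_comm]
        exact Finset.sum_congr rfl fun k _ => Finset.sum_comm
    _ = _ := by simp only [h1, h2]

theorem IsFDynamicalSystem.isClosed_adFixedPoints (hα : IsFDynamicalSystem F α) {Y : Set X}
    (hY : IsClosed[fTop F] Y) : IsClosed[fTopMat F π.dim] (adFixedPoints α Y π) := by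
  have hT := hα.dualPair.t2Space
  have hrw : adFixedPoints α Y π = {a | ∀ i j, a i j ∈ Y} ∩ ⋂ g, ⋂ i, ⋂ j,
      {a : Matrix (Fin π.dim) (Fin π.dim) X |
        ∑ k, ∑ l, (π.coeff g i k * π.coeff g⁻¹ l j) • α g (a k l) = a i j} := by
    ext a; simp [adFixedPoints]
  rw [hrw]
  refine @IsClosed.inter _ _ _ (fTopMat F π.dim) (isClosed_matrix hY) ?_
  refine @isClosed_iInter _ _ (fTopMat F _) _ fun g => @isClosed_iInter _ _ (fTopMat F _) _ fun i =>
    @isClosed_iInter _ _ (fTopMat F _) _ fun j =>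
    @isClosed_eq _ _ (fTop F) (fTopMat F _) hT _ _ ?_ (continuous_entry_fTopMat i j)
  refine @continuous_to_fTop _ _ _ _ _ (fTopMat F _) _ fun φ hφ => ?_
  simp only [map_sum, map_smul]
  refine continuous_sum_of fun k => continuous_sum_of fun l => continuous_const_mul_of _ ?_
  exact continuous_comp_of (fun x => φ (α g x)) (fun a : Matrix (Fin π.dim) (Fin π.dim) X => a k l)
    (continuous_comp_of φ _ (continuous_fTop_apply hφ) (hα.continuous_aut g))
    (continuous_entry_fTopMat k l)

/-- The inclusion that holds for every closed subalgebra. -/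
theorem IsFDynamicalSystem.closure_subset_adFixedPoints (hα : IsFDynamicalSystem F α)
    {Y : NonUnitalStarSubalgebra ℂ X} (hY : IsClosed[fTop F] (Y : Set X)) :
    closure[fTopMat F π.dim] (Submodule.span ℂ {c : Matrix (Fin π.dim) (Fin π.dim) X |
        ∃ a ∈ spectralSubspace α (Y : Set X) π, ∃ b ∈ spectralSubspace α (Y : Set X) π,
          c = a.conjTranspose * b} : Set (Matrix (Fin π.dim) (Fin π.dim) X)) ⊆
      adFixedPoints α (Y : Set X) π := by
  refine fun x hx => mem_of_mem_closure ?_ (hα.isClosed_adFixedPoints hY) hx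
  intro c hc
  induction hc using Submodule.span_induction with
  | zero => exact ⟨fun _ _ => zero_mem Y, fun g i j => by simp⟩
  | add a b _ _ ha hb =>
    refine ⟨fun i j => add_mem (ha.1 i j) (hb.1 i j), fun g i j => ?_⟩
    simp only [Matrix.add_apply, map_add, smul_add, Finset.sum_add_distrib, ha.2, hb.2]
  | smul c a _ ha =>
    refine ⟨fun i j => SMulMemClass.smul_mem c (ha.1 i j), fun g i j => ?_⟩
    simp only [Matrix.smul_apply, map_smul, smul_comm _ c, ← Finset.smul_sum, ha.2]
  | mem c hc =>
    obtain ⟨a, ha, b, hb, rfl⟩ := hc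
    exact conjTranspose_mul_mem_adFixedPoints ha hb

/-- For the zero algebra both sides of the defining equation of the spectrum vanish. -/
theorem IsFDynamicalSystem.closure_eq_adFixedPoints_of_forall_eq_zero
    (hα : IsFDynamicalSystem F α) {Y : NonUnitalStarSubalgebra ℂ X}
    (hY : IsClosed[fTop F] (Y : Set X)) (h0 : ∀ y ∈ Y, y = 0) :
    closure[fTopMat F π.dim] (Submodule.span ℂ {c : Matrix (Fin π.dim) (Fin π.dim) X |
        ∃ a ∈ spectralSubspace α (Y : Set X) π, ∃ b ∈ spectralSubspace α (Y : Set X) π,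
          c = a.conjTranspose * b} : Set (Matrix (Fin π.dim) (Fin π.dim) X)) =
      adFixedPoints α (Y : Set X) π := by
  refine Set.Subset.antisymm (hα.closure_subset_adFixedPoints hY) fun a ha => ?_
  have : a = 0 := by
    ext i j
    exact h0 _ (ha.1 i j)
  rw [this]
  exact @subset_closure _ (fTopMat F π.dim) _ _ (zero_mem (Submodule.span ℂ _))

variable [PartialOrder X] [StarOrderedRing X] [IsTopologicalGroup G] [CompactSpace G]

theorem IsFDynamicalSystem.exists_approx_unit_spectralSubspace (hα : IsFDynamicalSystem F α)
    {Y : NonUnitalStarSubalgebra ℂ X} (hY : IsClosed[fTop F] (Y : Set X))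
    (hinv : ∀ g, ∀ y ∈ Y, α g y ∈ Y) {a : Matrix (Fin π.dim) (Fin π.dim) X}
    (ha : a ∈ spectralSubspace α (Y : Set X) π) {ε : ℝ} (hε : 0 < ε) :
    ∃ e ∈ Y, e ∈ fixedPoints α ∧ ∀ i j, ‖a i j - e * a i j‖ ≤ ε := by
  obtain ⟨e, he, heα, h⟩ := hα.exists_fixed_approx_unit hY hinv
    (fun p : Fin π.dim × Fin π.dim => a p.1 p.2) (fun p => ha.1 _ _)
    (fun g p q => if p.1 = q.1 then π.coeff g q.2 p.2 else 0)
    (fun g p q => by split_ifs; exacts [π.norm_coeff_le _ _ _, by simp])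
    (fun g p => by
      rw [ha.2, Fintype.sum_prod_type]
      simp [ite_smul]) hε
  exact ⟨e, he, heα, fun i j => h (i, j)⟩

theorem IsFDynamicalSystem.exists_approx_unit_adFixedPoints_left (hα : IsFDynamicalSystem F α)
    {Y : NonUnitalStarSubalgebra ℂ X} (hY : IsClosed[fTop F] (Y : Set X))
    (hinv : ∀ g, ∀ y ∈ Y, α g y ∈ Y) {a : Matrix (Fin π.dim) (Fin π.dim) X}
    (ha : a ∈ adFixedPoints α (Y : Set X) π) {ε : ℝ} (hε : 0 < ε) :
    ∃ e ∈ Y, e ∈ fixedPoints α ∧ ∀ i j, ‖a i j - e * a i j‖ ≤ ε := by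
  obtain ⟨e, he, heα, h⟩ := hα.exists_fixed_approx_unit hY hinv
    (fun p : Fin π.dim × Fin π.dim => a p.1 p.2) (fun p => ha.1 _ _)
    (fun g p q => π.coeff g⁻¹ p.1 q.1 * π.coeff g q.2 p.2)
    (fun g p q => by
      rw [norm_mul]
      exact mul_le_one₀ (π.norm_coeff_le _ _ _) (norm_nonneg _) (π.norm_coeff_le _ _ _))
    (fun g p => by
      rw [aut_apply_of_mem_adFixedPoints ha, Fintype.sum_prod_type]) hε
  exact ⟨e, he, heα, fun i j => h (i, j)⟩

theorem IsFDynamicalSystem.exists_approx_unit_adFixedPoints_right (hα : IsFDynamicalSystem F α)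
    {Y : NonUnitalStarSubalgebra ℂ X} (hY : IsClosed[fTop F] (Y : Set X))
    (hinv : ∀ g, ∀ y ∈ Y, α g y ∈ Y) {a : Matrix (Fin π.dim) (Fin π.dim) X}
    (ha : a ∈ adFixedPoints α (Y : Set X) π) {ε : ℝ} (hε : 0 < ε) :
    ∃ e ∈ Y, e ∈ fixedPoints α ∧ ∀ i j, ‖a i j - a i j * e‖ ≤ ε := by
  obtain ⟨e, he, heα, h⟩ := hα.exists_fixed_approx_unit hY hinv
    (fun p : Fin π.dim × Fin π.dim => star (a p.1 p.2)) (fun p => star_mem (ha.1 _ _))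
    (fun g p q => star (π.coeff g⁻¹ p.1 q.1 * π.coeff g q.2 p.2))
    (fun g p q => by
      rw [norm_star, norm_mul]
      exact mul_le_one₀ (π.norm_coeff_le _ _ _) (norm_nonneg _) (π.norm_coeff_le _ _ _))
    (fun g p => by
      rw [map_star, aut_apply_of_mem_adFixedPoints ha, Fintype.sum_prod_type]
      simp only [star_sum, star_smul]) hε
  refine ⟨star e, star_mem he, star_mem_fixedPoints heα, fun i j => ?_⟩
  rw [← norm_star, star_sub, star_mul, star_star]
  exact h (i, j)

/-- To show that an element of `(Y ⊗ B(H))^{α ⊗ ad π}` belongs to a closed set, it may be cut down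
by fixed points of `Y`. -/
theorem IsFDynamicalSystem.mem_of_forall_map_mem (hα : IsFDynamicalSystem F α)
    {Y : NonUnitalStarSubalgebra ℂ X} (hY : IsClosed[fTop F] (Y : Set X))
    (hinv : ∀ g, ∀ y ∈ Y, α g y ∈ Y) {a : Matrix (Fin π.dim) (Fin π.dim) X}
    (ha : a ∈ adFixedPoints α (Y : Set X) π) {W : Set (Matrix (Fin π.dim) (Fin π.dim) X)}
    (hW : IsClosed[fTopMat F π.dim] W)
    (h : ∀ e ∈ Y, e ∈ fixedPoints α → ∀ e' ∈ Y, e' ∈ fixedPoints α →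
      a.map (sandwichMap e e') ∈ W) : a ∈ W := by
  refine mem_of_approx hW fun ε hε => ?_
  obtain ⟨e, he, heα, happ⟩ := hα.exists_approx_unit_adFixedPoints_left hY hinv ha hε
  -- The right unit is chosen after the left one, adapted to ea, so no joint estimate is needed.
  have hea : a.map (LinearMap.mulLeft ℂ e) ∈ adFixedPoints α (Y : Set X) π :=
    mem_adFixedPoints_map ha (fun g x => by simp [heα g]) fun i j => mul_mem he (ha.1 i j)
  refine ⟨_, mem_of_approx hW fun δ hδ => ?_, happ⟩
  obtain ⟨e', he', heα', happ'⟩ := hα.exists_approx_unit_adFixedPoints_right hY hinv hea hδ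
  exact ⟨_, h e he heα e' he' heα', happ'⟩

theorem IsFDynamicalSystem.adFixedPoints_subset_closure (hα : IsFDynamicalSystem F α)
    {Y : NonUnitalStarSubalgebra ℂ X} (hY : IsInvariantHereditary F α Y)
    (hπ : closure[fTopMat F π.dim] (Submodule.span ℂ {c : Matrix (Fin π.dim) (Fin π.dim) X |
        ∃ a ∈ spectralSubspace α (sandwich F (fixedIdeal F α Y)) π,
        ∃ b ∈ spectralSubspace α (sandwich F (fixedIdeal F α Y)) π,
          c = a.conjTranspose * b} : Set (Matrix (Fin π.dim) (Fin π.dim) X)) =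
      adFixedPoints α (sandwich F (fixedIdeal F α Y)) π) :
    adFixedPoints α (Y : Set X) π ⊆
    closure[fTopMat F π.dim] (Submodule.span ℂ {c : Matrix (Fin π.dim) (Fin π.dim) X |
        ∃ a ∈ spectralSubspace α (Y : Set X) π, ∃ b ∈ spectralSubspace α (Y : Set X) π,
          c = a.conjTranspose * b} : Set (Matrix (Fin π.dim) (Fin π.dim) X)) := by
  have hinv : ∀ g, ∀ y ∈ Y, α g y ∈ Y := fun g y hy => by
    have : α g y ∈ (Y : Set X) := hY.invariant g ▸ ⟨y, hy, rfl⟩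
    exact this
  have hYXY : ∀ {s t : X}, s ∈ Y → t ∈ Y → ∀ x, s * x * t ∈ Y := fun hs ht x =>
    mul_mul_mem_of_hereditary hY.hereditary hs ht x
  set J := fixedIdeal F α Y
  have hJ : IsFClosedIdeal F α J := hα.isFClosedIdeal_fixedIdeal Y
  obtain ⟨Z, hZ⟩ := hα.exists_coe_eq_sandwich (F := F) fun j hj => hJ.star_mem hj
  have hZmem : ∀ x, x ∈ Z ↔ x ∈ sandwich F J := fun x => by rw [← hZ]; rfl
  have hZcl : IsClosed[fTop F] (Z : Set X) := by rw [hZ]; exact isClosed_sandwich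
  have hZinv : ∀ g, ∀ z ∈ Z, α g z ∈ Z := fun g z hz =>
    (hZmem _).2 (hα.aut_mem_sandwich hJ.subset g ((hZmem _).1 hz))
  intro a ha
  set W := closure[fTopMat F π.dim] (Submodule.span ℂ {c : Matrix (Fin π.dim) (Fin π.dim) X |
        ∃ a ∈ spectralSubspace α (Y : Set X) π, ∃ b ∈ spectralSubspace α (Y : Set X) π,
          c = a.conjTranspose * b} : Set (Matrix (Fin π.dim) (Fin π.dim) X))
  have hW : IsClosed[fTopMat F π.dim] W := @isClosed_closure _ (fTopMat F π.dim) _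
  have haZ : a ∈ adFixedPoints α (sandwich F J) π :=
    ⟨hα.mem_of_forall_map_mem hY.isClosed hinv ha (isClosed_matrix isClosed_sandwich)
      fun e he heα e' he' heα' i j => mul_mem_sandwich (hα.mem_fixedIdeal hY.isClosed he heα)
        (hα.mem_fixedIdeal hY.isClosed he' heα') _, ha.2⟩
  refine hα.mem_of_forall_map_mem hY.isClosed hinv ha hW fun e he heα e' he' heα' => ?_
  rw [← hπ] at haZ
  refine map_mem_closure_of_mem_closure_span isTopologicalAddGroup_fTopMat continuousSMul_fTopMat
    (sandwichMap e e').mapMatrix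
    (continuous_mapMatrix (hα.continuous_sandwichMap e e')) ?_ haZ
  rintro _ ⟨b, hb, c, hc, rfl⟩
  -- T(z) = e b^* z c e', linear and F-continuous in z, so that T(J) ⊂ W need only be checked on
  -- generators of J.
  let T : X →ₗ[ℂ] Matrix (Fin π.dim) (Fin π.dim) X :=
    { toFun := fun z => Matrix.of fun i j => ∑ k, e * (star (b k i) * (z * c k j)) * e'
      map_add' := fun x y => by
        ext i j
        simp only [Matrix.of_apply, Matrix.add_apply, add_mul, mul_add, Finset.sum_add_distrib]
      map_smul' := fun r x => by
        ext i j
        simp only [Matrix.of_apply, Matrix.smul_apply, smul_mul_assoc, mul_smul_comm,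
          Finset.smul_sum, RingHom.id_apply] }
  have hTapp : ∀ z i j, T z i j = ∑ k, e * (star (b k i) * (z * c k j)) * e' := fun _ _ _ => rfl
  have hT : Continuous[fTop F, fTopMat F π.dim] T := by
    refine @continuous_to_fTopMat _ _ _ _ _ (fTop F) _ _ fun i j =>
      @continuous_to_fTop _ _ _ _ _ (fTop F) _ fun φ hφ => ?_
    simp only [hTapp, map_sum]
    refine continuous_sum_of fun k => ?_
    exact continuous_comp_of (fun x => φ (e * (star (b k i) * x) * e')) (fun z => z * c k j)
      (continuous_comp_of (fun x => φ (e * x * e')) (fun x => star (b k i) * x)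
        (continuous_comp_of φ _ (continuous_fTop_apply hφ) (hα.continuous_sandwichMap e e'))
        (hα.continuous_mul_left _)) (hα.continuous_mul_right _)
  have hTJ : ∀ z ∈ J, T z ∈ W := fun z hz => by
    refine map_mem_closure_of_mem_closure_span isTopologicalAddGroup_fTopMat continuousSMul_fTopMat
      T hT ?_ hz
    rintro _ ⟨x, hx, y, hy, y', hy', x', hx', hyY, hyY', rfl⟩
    -- The generator x y y' x' is split between y and y': each half supplies an element of Y on the
    -- left, while e or e' supplies one on the right.
    refine @subset_closure _ (fTopMat F π.dim) _ _ (Submodule.subset_span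
      ⟨_, mem_spectralSubspace_map hb (star_mem_fixedPoints (mul_mem_fixedPoints hx hy))
          (star_mem_fixedPoints heα) fun i j => ?_,
        _, mem_spectralSubspace_map hc (mul_mem_fixedPoints hy' hx') heα' fun i j => ?_, ?_⟩)
    · rw [star_mul, mul_assoc (star y)]
      exact hYXY (star_mem hyY) (star_mem he) _
    · rw [mul_assoc y']
      exact hYXY hyY' he' _
    · ext i j
      rw [hTapp]
      simp only [Matrix.mul_apply, Matrix.conjTranspose_apply, Matrix.map_apply, sandwichMap_apply,
        star_mul, star_star, mul_assoc]
  refine mem_of_approx hW fun ε hε => ?_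
  set B := ∑ k, ∑ i, ‖b k i‖ with hB
  have hB0 : 0 ≤ B := Finset.sum_nonneg fun _ _ => Finset.sum_nonneg fun _ _ => norm_nonneg _
  rw [← hZ] at hc
  -- A fixed point z of the sandwich with zc ≈ c lies in J, so T(z) ∈ W approximates e b^*c e'; the
  -- tolerance absorbs ‖e‖, ‖e'‖ and the norms of the entries of b.
  obtain ⟨z, hz, hzα, happ⟩ := hα.exists_approx_unit_spectralSubspace hZcl hZinv hc
    (ε := ε / (‖e‖ * B * ‖e'‖ + 1)) (by positivity)
  refine ⟨T z, hTJ z (hα.mem_of_mem_sandwich hJ ((hZmem z).1 hz) hzα), fun i j => ?_⟩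
  set δ := ε / (‖e‖ * B * ‖e'‖ + 1) with hδ
  have hdiff : (sandwichMap e e').mapMatrix (b.conjTranspose * c) i j - T z i j =
      e * (∑ k, star (b k i) * (c k j - z * c k j)) * e' := by
    rw [hTapp, LinearMap.mapMatrix_apply, Matrix.map_apply, sandwichMap_apply, Matrix.mul_apply]
    simp only [Matrix.conjTranspose_apply, mul_sub, Finset.sum_sub_distrib, sub_mul, Finset.mul_sum,
      Finset.sum_mul]
  have hsum : ‖∑ k, star (b k i) * (c k j - z * c k j)‖ ≤ B * δ := by
    rw [hB, Finset.sum_mul]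
    refine norm_sum_le_of_le _ fun k _ => (norm_mul_le _ _).trans ?_
    rw [norm_star]
    exact mul_le_mul (Finset.single_le_sum (f := fun i => ‖b k i‖) (fun _ _ => norm_nonneg _)
      (Finset.mem_univ i)) (happ k j) (norm_nonneg _)
      (Finset.sum_nonneg fun _ _ => norm_nonneg _)
  rw [hdiff]
  calc _ ≤ ‖e‖ * (B * δ) * ‖e'‖ := (norm_mul_le _ _).trans
        (mul_le_mul_of_nonneg_right ((norm_mul_le _ _).trans
          (mul_le_mul_of_nonneg_left hsum (norm_nonneg _))) (norm_nonneg _))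
    _ = ‖e‖ * B * ‖e'‖ * δ := by ring
    _ ≤ ε := by
      rw [hδ, mul_div_assoc', div_le_iff₀ (by positivity)]
      nlinarith

end Spectral

end FDyn

theorem theorem3p4 {X : Type*} [NonUnitalCStarAlgebra X] [PartialOrder X] [StarOrderedRing X]
    {G : Type*} [Group G] [TopologicalSpace G] [IsTopologicalGroup G] [CompactSpace G]
    (F : Submodule ℂ (StrongDual ℂ X)) (α : G →* (X ≃⋆ₐ[ℂ] X))
    (hα : FDyn.IsFDynamicalSystem F α) :
    FDyn.strongConnesSpectrum F α =
      ⋂ J ∈ {J : Submodule ℂ X | FDyn.IsFClosedIdeal F α J},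
        FDyn.strongArvesonSpectrum F α (FDyn.sandwich F J) := by
  refine Set.Subset.antisymm (fun π hπ => Set.mem_iInter₂.2 fun J hJ => ?_) fun π hπ Y hY => ?_
  -- The zero ideal is separate because the Connes spectrum runs over non-zero subalgebras only.
  · by_cases hne : J = ⊥
    · obtain ⟨Z, hZ⟩ := hα.exists_coe_eq_sandwich (F := F) (J := J)
        fun j hj => FDyn.IsFClosedIdeal.star_mem hJ hj
      have h0 : ∀ z ∈ Z, z = 0 := fun z hz => by
        have hz' : z ∈ FDyn.sandwich F J := hZ ▸ hz
        have hT := hα.dualPair.t2Space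
        refine FDyn.mem_of_mem_closure (C := {0}) ?_ (@isClosed_singleton _ (FDyn.fTop F) _ 0) hz'
        intro x hx
        have hle : Submodule.span ℂ {z : X | ∃ j ∈ J, ∃ x : X, ∃ k ∈ J, z = j * x * k} ≤ ⊥ := by
          rw [Submodule.span_le]
          rintro _ ⟨j, hj, x, k, -, rfl⟩
          rw [hne, Submodule.mem_bot] at hj
          simp [hj]
        exact hle hx
      rw [← hZ]
      exact hα.closure_eq_adFixedPoints_of_forall_eq_zero (by rw [hZ]; exact FDyn.isClosed_sandwich)
        h0
    · obtain ⟨Z, hZ, hZH⟩ := hα.exists_isInvariantHereditary_sandwich hJ hne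
      rw [← hZ]
      exact hπ Z hZH
  · exact Set.Subset.antisymm (hα.closure_subset_adFixedPoints hY.isClosed)
      (hα.adFixedPoints_subset_closure hY
        (Set.mem_iInter₂.1 hπ (FDyn.fixedIdeal F α Y) (hα.isFClosedIdeal_fixedIdeal Y)))
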